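/- Let $N, L \ge 2$ and $m \ge 1$ be integers, let $\rho^{-1} = NL$, and let $$D=\{0,1,\dots,N-1\}+ m\{0,1,\dots,L-1\}=\{a+mb : 0\le a<N,\ 0\le b<L\}.$$ Let $T=T(\rho,D)=\bigl\{\sum_{j=1}^{\infty}\rho^{j}d_j : d_j\in D \text{ for all } j\ge 1\bigr\}$ be the associated self-similar set, that is, the unique nonempty compact set satisfying $T=\bigcup_{d\in D}\rho(T+d)$. Then $T$ is a spectral set if and only if $T$ is a translation tile of $\mathbb{R}$. Here a Lebesgue measurable set $\Omega\subseteq\mathbb{R}$ is a *spectral set* if it has positive finite Lebesgue measure, its normalized Lebesgue measure $\mu = |\Omega|^{-1}\chi_\Omega\,dx$ has compact support, and there is a countable set $\Lambda\subset\mathbb{R}$ such that $\{e^{2\pi i\lambda x}\}_{\lambda\in\Lambda}$ is an orthonormal basis of $L^2(\mu)$. It is a *translation tile* of $\mathbb{R}$ if there is a countable set $\Gamma\subset\mathbb{R}$ such that the translates $\Omega+\gamma$, $\gamma\in\Gamma$, cover $\mathbb{R}$ up to a Lebesgue null set and overlap pairwise only in Lebesgue null sets. -/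

import Mathlib

open MeasureTheory
open scoped Pointwise

noncomputable section

/-- The consecutive digit set `{0, 1, …, n - 1}`, as a set of real numbers. -/
def consecutiveDigits (n : ℕ) : Set ℝ := (fun k : ℕ => (k : ℝ)) '' Set.Iio n

/-- The digit set `{0, …, N - 1} + m {0, …, L - 1}`. -/
def productDigits (N m L : ℕ) : Set ℝ :=
  consecutiveDigits N + (m : ℝ) • consecutiveDigits L

/-- The self-similar set `T(ρ, D)`, given by its radix expansion `∑_{j ≥ 1} ρ ^ j d_j`. -/
def selfSimilarSet (ρ : ℝ) (D : Set ℝ) : Set ℝ :=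
  {x | ∃ d : ℕ → ℝ, (∀ j, d j ∈ D) ∧ HasSum (fun j => ρ ^ (j + 1) * d j) x}

/-- For `0 < ρ < 1` and a finite nonempty digit set `D`, the set `T(ρ, D)` is the unique
nonempty compact set `K` with `K = ⋃_{d ∈ D} ρ (K + d)`. -/
theorem isAttractor_iff_eq_selfSimilarSet {ρ : ℝ} (h0 : 0 < ρ) (h1 : ρ < 1) {D : Set ℝ}
    (hD : D.Finite) (hne : D.Nonempty) (K : Set ℝ) :
    (K.Nonempty ∧ IsCompact K ∧ K = ⋃ d ∈ D, (fun x => ρ * (x + d)) '' K) ↔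
      K = selfSimilarSet ρ D := by
  obtain ⟨M, hM⟩ : ∃ M, ∀ d ∈ D, |d| ≤ M := by
    obtain ⟨M, hM⟩ := hD.isBounded.exists_norm_le
    exact ⟨M, hM⟩
  have hgeo : Summable (fun j : ℕ => ρ ^ (j + 1) * M) :=
    ((summable_geometric_of_lt_one h0.le h1).comp_injective (add_left_injective 1)).mul_right M
  have hbd : ∀ d : ℕ → ℝ, (∀ j, d j ∈ D) → ∀ j, ‖ρ ^ (j + 1) * d j‖ ≤ ρ ^ (j + 1) * M := by
    intro d hd j
    rw [norm_mul, Real.norm_of_nonneg (by positivity)]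
    exact mul_le_mul_of_nonneg_left (hM _ (hd j)) (by positivity)
  have hsum : ∀ d : ℕ → ℝ, (∀ j, d j ∈ D) → Summable (fun j => ρ ^ (j + 1) * d j) :=
    fun d hd => Summable.of_norm_bounded hgeo (hbd d hd)
  have key : ∀ (d : ℕ → ℝ) (x : ℝ), HasSum (fun j => ρ ^ (j + 1) * d (j + 1)) x →
      HasSum (fun j => ρ ^ (j + 1) * d j) (ρ * (x + d 0)) := by
    intro d x hx
    rw [← hasSum_nat_add_iff' 1]
    have hf : (fun j => ρ ^ (j + 1 + 1) * d (j + 1)) =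
        fun j => ρ * (ρ ^ (j + 1) * d (j + 1)) := by
      funext j; ring
    have hv : ρ * (x + d 0) - ∑ i ∈ Finset.range 1, ρ ^ (i + 1) * d i = ρ * x := by
      rw [Finset.sum_range_one]; ring
    rw [hv, hf]
    exact hx.mul_left ρ
  constructor
  · rintro ⟨⟨x₀, hx₀⟩, hK, hKeq⟩
    obtain ⟨C, hC⟩ := hK.isBounded.exists_norm_le
    have htend : ∀ y : ℕ → ℝ, (∀ n, y n ∈ K) →
        Filter.Tendsto (fun n => ρ ^ n * y n) Filter.atTop (nhds 0) := by
      intro y hy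
      have h2 : Filter.Tendsto (fun n : ℕ => ρ ^ n * C) Filter.atTop (nhds 0) := by
        simpa using (tendsto_pow_atTop_nhds_zero_of_lt_one h0.le h1).mul_const C
      refine squeeze_zero_norm (fun n => ?_) h2
      rw [norm_mul, Real.norm_of_nonneg (by positivity)]
      exact mul_le_mul_of_nonneg_left (hC _ (hy n)) (by positivity)
    ext x
    constructor
    · intro hx
      have hstep : ∀ y : K, ∃ z : K, ∃ d ∈ D, (y : ℝ) = ρ * (z + d) := by
        rintro ⟨y, hy⟩
        rw [hKeq] at hy
        simp only [Set.mem_iUnion, Set.mem_image] at hy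
        obtain ⟨d, hd, z, hz, rfl⟩ := hy
        exact ⟨⟨z, hz⟩, d, hd, rfl⟩
      choose f g hg hfg using hstep
      let y : ℕ → K := fun n => f^[n] ⟨x, hx⟩
      have hy : ∀ n, (y n : ℝ) = ρ * (y (n + 1) + g (y n)) := by
        intro n
        have : y (n + 1) = f (y n) := Function.iterate_succ_apply' f n _
        rw [this]; exact hfg _
      refine ⟨fun n => g (y n), fun n => hg _, ?_⟩
      have hpart : ∀ n, ∑ j ∈ Finset.range n, ρ ^ (j + 1) * g (y j) = x - ρ ^ n * y n := by
        intro n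
        induction n with
        | zero => simp [y]
        | succ n ih =>
          rw [Finset.sum_range_succ, ih]
          conv_lhs => rw [hy n]
          ring
      rw [(hsum _ (fun n => hg _)).hasSum_iff_tendsto_nat]
      simp only [hpart]
      simpa using (htend (fun n => y n) (fun n => (y n).2)).const_sub x
    · rintro ⟨d, hd, hx⟩
      have hmem : ∀ n : ℕ, ∀ e : ℕ → ℝ, (∀ j, e j ∈ D) →
          ∑ j ∈ Finset.range n, ρ ^ (j + 1) * e j + ρ ^ n * x₀ ∈ K := by
        intro n
        induction n with
        | zero => intro e _; simpa using hx₀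
        | succ n ih =>
          intro e he
          rw [hKeq]
          simp only [Set.mem_iUnion, Set.mem_image]
          refine ⟨e 0, he 0, _, ih (fun j => e (j + 1)) (fun j => he _), ?_⟩
          rw [Finset.sum_range_succ', mul_add, mul_add, Finset.mul_sum]
          simp only [pow_succ, pow_zero, one_mul]
          have : ∀ j, ρ * (ρ ^ j * ρ * e (j + 1)) = ρ ^ j * ρ * ρ * e (j + 1) := by
            intro j; ring
          simp only [this]
          ring
      refine hK.isClosed.mem_of_tendsto
        (b := Filter.atTop) (f := fun n : ℕ =>
          ∑ j ∈ Finset.range n, ρ ^ (j + 1) * d j + ρ ^ n * x₀) ?_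
        (Filter.Eventually.of_forall fun n => hmem n d hd)
      simpa using hx.tendsto_sum_nat.add (htend (fun _ => x₀) (fun _ => hx₀))
  · rintro rfl
    refine ⟨?_, ?_, ?_⟩
    · obtain ⟨d, hd⟩ := hne
      exact ⟨_, fun _ => d, fun _ => hd, (hsum _ fun _ => hd).hasSum⟩
    · have : selfSimilarSet ρ D =
          (fun d : ℕ → ℝ => ∑' j, ρ ^ (j + 1) * d j) '' Set.univ.pi (fun _ => D) := by
        ext x
        constructor
        · rintro ⟨d, hd, hx⟩
          exact ⟨d, fun j _ => hd j, hx.tsum_eq⟩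
        · rintro ⟨d, hd, rfl⟩
          exact ⟨d, fun j => hd j trivial, (hsum d fun j => hd j trivial).hasSum⟩
      rw [this]
      refine (isCompact_univ_pi fun _ => hD.isCompact).image_of_continuousOn ?_
      exact continuousOn_tsum (fun j => by fun_prop) hgeo
        (fun j d hd => hbd d (fun j => hd j trivial) j)
    · ext x
      simp only [Set.mem_iUnion, Set.mem_image]
      constructor
      · rintro ⟨d, hd, hx⟩
        obtain ⟨y, hs⟩ := hsum (fun j => d (j + 1)) (fun j => hd (j + 1))
        exact ⟨d 0, hd 0, y, ⟨fun j => d (j + 1), fun j => hd (j + 1), hs⟩,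
          (key d y hs).unique hx⟩
      · rintro ⟨d₀, hd₀, z, ⟨d, hd, hz⟩, rfl⟩
        let e : ℕ → ℝ := fun n => Nat.casesOn n d₀ d
        have he : ∀ j, e j ∈ D := by
          rintro (_ | j)
          · exact hd₀
          · exact hd j
        exact ⟨e, he, key e z hz⟩

/-- `Λ` is a spectrum of `μ`: it is countable and the exponentials `x ↦ e^{2πiλx}`, `λ ∈ Λ`,
form an orthonormal basis of `L²(μ)`. -/
def IsSpectrum (μ : Measure ℝ) (Λ : Set ℝ) : Prop :=
  Λ.Countable ∧ ∃ b : HilbertBasis Λ ℂ (Lp ℂ 2 μ), ∀ l : Λ,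
    ⇑(b l) =ᵐ[μ] fun x : ℝ => Complex.exp (2 * Real.pi * Complex.I * (l : ℝ) * x)

/-- A spectral measure: a Borel probability measure with compact support that has a spectrum. -/
def IsSpectralMeasure (μ : Measure ℝ) : Prop :=
  IsProbabilityMeasure μ ∧ (∃ K : Set ℝ, IsCompact K ∧ μ Kᶜ = 0) ∧ ∃ Λ : Set ℝ, IsSpectrum μ Λ

/-- A spectral set: a Lebesgue measurable set whose normalized Lebesgue measure
`(volume Ω)⁻¹ • volume.restrict Ω` is a spectral measure. Since this has to be a probability
measure, `Ω` has positive finite Lebesgue measure. -/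
def IsSpectralSet (Ω : Set ℝ) : Prop :=
  NullMeasurableSet Ω volume ∧ IsSpectralMeasure ((volume Ω)⁻¹ • volume.restrict Ω)

/-- A translation tile of `ℝ`: a Lebesgue measurable set with countably many translates that
cover `ℝ` up to a null set and overlap pairwise in null sets. -/
def IsTranslationTile (Ω : Set ℝ) : Prop :=
  NullMeasurableSet Ω volume ∧ ∃ Γ : Set ℝ, Γ.Countable ∧
    volume (⋃ t ∈ Γ, (t +ᵥ Ω))ᶜ = 0 ∧
    Γ.Pairwise fun s t => volume ((s +ᵥ Ω) ∩ (t +ᵥ Ω)) = 0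

end

/-! If T is a null set, it is neither spectral nor a tile. If T has positive measure, it is both, so
the equivalence holds because the two sides are proved separately.

Tiling: T has integer base b = NL and b integer digits, so the pieces of b^n T are integer
translates of T with null overlaps. Blowing up around a Lebesgue density point fills ever larger
balls, and a limit of the resulting sets of integers is a tiling set
(`IsDigitTile.isTranslationTile`).

Spectrality: put Φ = |μ̂|² for the normalized measure μ on T. Positive measure gives Φ = 0 at the
nonzero integers (`IsDigitTile.expIntegral_int`), and Φ(1) = 0 forces N ∣ m. A spectrum S/m + ℤ is
sought, with S a finite orthogonal set of integers of largest cardinality. Parseval requires the sum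
of Φ over ξ + S/m + ℤ to be at least 1. This sum has a minimum over all such S and all ξ. The
refinement equation bounds each sum below by a weighted average of such sums for other maximal sets
(`spectralSum_eq_sum_fiber`, `exists_section_le_sum_average`), so minimality passes from ξ to ξ/(NL)
as long as Φ(ξ) ≠ 0 (`descent`). Iterating drives the point to 0, where Φ = 1, so the minimum is at
least 1. -/

noncomputable section

/-! ### Characters and the masks of consecutive digit sets. -/

/-- The character `t ↦ e^{2πit}` of `ℝ`. -/
def unitExp (t : ℝ) : ℂ := Complex.exp (2 * Real.pi * Complex.I * t)

theorem unitExp_add (s t : ℝ) : unitExp (s + t) = unitExp s * unitExp t := by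
  simp only [unitExp, ← Complex.exp_add]
  push_cast
  ring_nf

theorem norm_unitExp (t : ℝ) : ‖unitExp t‖ = 1 := by
  have : (2 * Real.pi * Complex.I * t : ℂ) = ((2 * Real.pi * t : ℝ) : ℂ) * Complex.I := by
    push_cast; ring
  rw [unitExp, this, Complex.norm_exp_ofReal_mul_I]

theorem unitExp_zero : unitExp 0 = 1 := by simp [unitExp]

theorem unitExp_eq_one_iff {t : ℝ} : unitExp t = 1 ↔ ∃ j : ℤ, t = j := by
  rw [unitExp, Complex.exp_eq_one_iff]
  have h : (2 * Real.pi * Complex.I : ℂ) ≠ 0 := Complex.two_pi_I_ne_zero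
  refine exists_congr fun j => ?_
  rw [mul_comm, mul_left_inj' h]
  norm_cast

theorem unitExp_int (j : ℤ) : unitExp j = 1 := unitExp_eq_one_iff.2 ⟨j, rfl⟩

theorem unitExp_neg (t : ℝ) : unitExp (-t) = (starRingEnd ℂ) (unitExp t) := by
  rw [unitExp, unitExp, ← Complex.exp_conj]
  simp [map_ofNat]

theorem unitExp_nat_mul (n : ℕ) (t : ℝ) : unitExp (n * t) = unitExp t ^ n := by
  rw [unitExp, unitExp, ← Complex.exp_nat_mul]
  push_cast
  ring_nf

theorem continuous_unitExp : Continuous unitExp := by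
  unfold unitExp
  fun_prop

/-- The squared modulus of the Fourier transform of the uniform distribution on
`{0, …, n - 1}`. -/
def digitMask (n : ℕ) (ξ : ℝ) : ℝ := ‖∑ a ∈ Finset.range n, unitExp (a * ξ)‖ ^ 2 / (n : ℝ) ^ 2

theorem digitMask_nonneg (n : ℕ) (ξ : ℝ) : 0 ≤ digitMask n ξ := by
  unfold digitMask; positivity

theorem digitMask_add_int (n : ℕ) (ξ : ℝ) (j : ℤ) : digitMask n (ξ + j) = digitMask n ξ := by
  unfold digitMask
  congr 3
  refine Finset.sum_congr rfl fun a _ => ?_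
  rw [unitExp_nat_mul, unitExp_nat_mul, unitExp_add, unitExp_int, mul_one]

theorem digitMask_int {n : ℕ} (hn : n ≠ 0) (j : ℤ) : digitMask n j = 1 := by
  have : (n : ℝ) ≠ 0 := by exact_mod_cast hn
  simp [digitMask, unitExp_nat_mul, unitExp_int, this]

theorem digitMask_eq_zero {n : ℕ} (hn : n ≠ 0) {ξ : ℝ} (h : digitMask n ξ = 0) :
    (∃ j : ℤ, n * ξ = j) ∧ ¬ ∃ j : ℤ, ξ = j := by
  constructor
  · have hn' : (n : ℝ) ≠ 0 := by exact_mod_cast hn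
    have h0 : ∑ a ∈ Finset.range n, unitExp ξ ^ a = 0 := by
      simpa [digitMask, hn', unitExp_nat_mul] using h
    rw [← unitExp_eq_one_iff, unitExp_nat_mul]
    have := mul_geom_sum (unitExp ξ) n
    rw [h0, mul_zero] at this
    exact (sub_eq_zero.1 this.symm)
  · rintro ⟨j, rfl⟩
    rw [digitMask_int hn] at h
    exact one_ne_zero h

theorem sum_unitExp_mul_div {n : ℕ} (hn : n ≠ 0) (j : ℤ) :
    ∑ k ∈ Finset.range n, unitExp (k * (j / n)) = if (n : ℤ) ∣ j then (n : ℂ) else 0 := by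
  have hn' : (n : ℝ) ≠ 0 := by exact_mod_cast hn
  simp only [unitExp_nat_mul]
  split_ifs with h
  · obtain ⟨i, rfl⟩ := h
    have : unitExp (((n * i : ℤ) : ℝ) / n) = 1 :=
      unitExp_eq_one_iff.2 ⟨i, by push_cast; field_simp⟩
    simp only [this, one_pow]
    simp
  · have h1 : unitExp ((j : ℝ) / n) ≠ 1 := by
      rw [Ne, unitExp_eq_one_iff]
      rintro ⟨i, hi⟩
      refine h ⟨i, ?_⟩
      rw [div_eq_iff hn'] at hi
      have : (j : ℝ) = ((n * i : ℤ) : ℝ) := by rw [hi]; push_cast; ring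
      exact_mod_cast this
    rw [geom_sum_eq h1, ← unitExp_nat_mul, mul_div_cancel₀ _ hn', unitExp_int, sub_self, zero_div]

/-- Expanding the squares and summing over `k` first, orthogonality of the characters of ℤ/n leaves
only the diagonal terms. The values thus serve as probability weights in the averaging argument. -/
theorem sum_digitMask {n : ℕ} (hn : n ≠ 0) (ξ : ℝ) :
    ∑ k ∈ Finset.range n, digitMask n (ξ + k / n) = 1 := by
  have hn' : (n : ℝ) ≠ 0 := by exact_mod_cast hn
  unfold digitMask
  rw [← Finset.sum_div, div_eq_one_iff_eq (by positivity)]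
  have key : ((∑ k ∈ Finset.range n, ‖∑ a ∈ Finset.range n, unitExp (a * (ξ + k / n))‖ ^ 2 : ℝ) : ℂ)
      = (n : ℂ) ^ 2 := by
    have h1 : ∀ k ∈ Finset.range n,
        ((‖∑ a ∈ Finset.range n, unitExp (a * (ξ + k / n))‖ ^ 2 : ℝ) : ℂ) =
        ∑ a ∈ Finset.range n, ∑ c ∈ Finset.range n,
          unitExp ((a - c : ℝ) * ξ) * unitExp (k * (((a - c : ℤ) : ℝ) / n)) := by
      intro k _
      push_cast
      rw [← Complex.mul_conj', map_sum, Finset.sum_mul_sum]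
      refine Finset.sum_congr rfl fun a _ => Finset.sum_congr rfl fun c _ => ?_
      rw [← unitExp_neg, ← unitExp_add, ← unitExp_add]
      congr 1
      ring
    push_cast at h1 ⊢
    rw [Finset.sum_congr rfl h1, Finset.sum_comm]
    have h2 : ∀ a ∈ Finset.range n, ∑ k ∈ Finset.range n, ∑ c ∈ Finset.range n,
        unitExp ((a - c : ℝ) * ξ) * unitExp (k * (((a : ℝ) - c) / n)) = n := by
      intro a ha
      rw [Finset.sum_comm, Finset.sum_eq_single a]
      · simp [unitExp_zero]
      · intro c hc hca
        rw [← Finset.mul_sum]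
        have := sum_unitExp_mul_div hn ((a : ℤ) - c)
        push_cast at this
        rw [this, if_neg, mul_zero]
        intro hd
        have := Int.eq_zero_of_abs_lt_dvd hd (by
          rw [Finset.mem_range] at ha hc
          rw [abs_lt]; constructor <;> omega)
        omega
      · exact fun h => absurd ha h
    rw [Finset.sum_congr rfl h2]
    simp [sq]
  exact_mod_cast key

end

/-! ### The refinement equation, zeros of Φ and its periodization. -/

noncomputable section

/-- The properties of the squared modulus `Φ = |μ̂|²` of the Fourier transform of the uniform
distribution `μ` on the self-similar set that are used in the construction of a spectrum. -/
structure IsRefinable (N m L : ℕ) (Φ : ℝ → ℝ) : Prop where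
  two_le_N : 2 ≤ N
  two_le_L : 2 ≤ L
  one_le_m : 1 ≤ m
  continuous : Continuous Φ
  nonneg : ∀ ξ, 0 ≤ Φ ξ
  zero : Φ 0 = 1
  neg : ∀ ξ, Φ (-ξ) = Φ ξ
  int : ∀ n : ℤ, n ≠ 0 → Φ n = 0
  refine : ∀ ξ, Φ (N * L * ξ) = digitMask N ξ * digitMask L (m * ξ) * Φ ξ
  summable : ∀ ξ, Summable fun n : ℤ => Φ (ξ + n)

namespace IsRefinable

variable {N m L : ℕ} {Φ : ℝ → ℝ}

theorem N_pos (h : IsRefinable N m L Φ) : (0 : ℝ) < N := by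
  have := h.two_le_N
  exact_mod_cast (by omega : 0 < N)

theorem L_pos (h : IsRefinable N m L Φ) : (0 : ℝ) < L := by
  have := h.two_le_L
  exact_mod_cast (by omega : 0 < L)

theorem m_pos (h : IsRefinable N m L Φ) : (0 : ℝ) < m := by
  have := h.one_le_m
  exact_mod_cast (by omega : 0 < m)

theorem N_ne (h : IsRefinable N m L Φ) : N ≠ 0 := by have := h.two_le_N; omega

theorem L_ne (h : IsRefinable N m L Φ) : L ≠ 0 := by have := h.two_le_L; omega

theorem base_gt_one (h : IsRefinable N m L Φ) : (1 : ℝ) < N * L := by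
  have h1 := h.two_le_N
  have h2 := h.two_le_L
  exact_mod_cast (by nlinarith : 1 < N * L)

theorem tendsto_div_pow (h : IsRefinable N m L Φ) (ξ : ℝ) :
    Filter.Tendsto (fun j : ℕ => Φ (ξ / (N * L : ℝ) ^ j)) Filter.atTop (nhds 1) := by
  have h1 : Filter.Tendsto (fun j : ℕ => ξ / (N * L : ℝ) ^ j) Filter.atTop (nhds 0) :=
    tendsto_const_nhds.div_atTop (tendsto_pow_atTop_atTop_of_one_lt h.base_gt_one)
  have h2 := (h.continuous.tendsto 0).comp h1
  rw [h.zero] at h2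
  exact h2

theorem refine_div (h : IsRefinable N m L Φ) (ξ : ℝ) :
    Φ ξ = digitMask N (ξ / (N * L)) * digitMask L (m * (ξ / (N * L))) * Φ (ξ / (N * L)) := by
  have hb : (N * L : ℝ) ≠ 0 := by have := h.base_gt_one; positivity
  rw [← h.refine, mul_div_cancel₀ _ hb]

/-- A zero of `Φ` comes from a zero of one of the factors of the infinite product. -/
theorem exists_mask_eq_zero (h : IsRefinable N m L Φ) {ξ : ℝ} (h0 : Φ ξ = 0) :
    ∃ j : ℕ, digitMask N (ξ / (N * L : ℝ) ^ (j + 1)) = 0 ∨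
      digitMask L (m * (ξ / (N * L : ℝ) ^ (j + 1))) = 0 := by
  by_contra! hne
  have h1 : ∀ j : ℕ, Φ (ξ / (N * L : ℝ) ^ j) = 0 := by
    intro j
    induction j with
    | zero => simpa using h0
    | succ j ih =>
      rw [h.refine_div, div_div, ← pow_succ] at ih
      have := hne j
      simpa [this.1, this.2] using ih
  have h2 := h.tendsto_div_pow ξ
  simp only [h1] at h2
  exact zero_ne_one (tendsto_nhds_unique tendsto_const_nhds h2)

/-- The zeros of `Φ` lie in `N / m * ℤ` or in `L * ℤ`. -/
theorem zero_cases (h : IsRefinable N m L Φ) {ξ : ℝ} (h0 : Φ ξ = 0) :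
    (∃ i : ℤ, ξ = L * i) ∨ ∃ i : ℤ, m * ξ = N * i := by
  have hN := h.N_pos
  have hL := h.L_pos
  obtain ⟨j, hj | hj⟩ := h.exists_mask_eq_zero h0
  · left
    obtain ⟨⟨i, hi⟩, -⟩ := digitMask_eq_zero h.N_ne hj
    refine ⟨i * (N * L : ℕ) ^ j, ?_⟩
    push_cast
    rw [← hi, pow_succ]
    field_simp
  · right
    obtain ⟨⟨i, hi⟩, -⟩ := digitMask_eq_zero h.L_ne hj
    refine ⟨i * (N * L : ℕ) ^ j, ?_⟩
    push_cast
    rw [← hi, pow_succ]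
    field_simp

/-- The point 1 is a zero of Φ and is not a multiple of `L ≥ 2`, so the other family of zeros must
contain it. -/
theorem N_dvd_m (h : IsRefinable N m L Φ) : N ∣ m := by
  have h0 := h.int 1 one_ne_zero
  rcases h.zero_cases h0 with ⟨i, hi⟩ | ⟨i, hi⟩
  · exfalso
    have h1 : (1 : ℤ) = L * i := by exact_mod_cast hi
    have h2 := Int.isUnit_iff.1 (IsUnit.of_mul_eq_one _ h1.symm)
    have := h.two_le_L
    omega
  · have h1 : (m : ℤ) = N * i := by
      have : ((m : ℤ) : ℝ) = ((N * i : ℤ) : ℝ) := by push_cast; simpa using hi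
      exact_mod_cast this
    exact Int.natCast_dvd_natCast.1 ⟨i, h1⟩

theorem exists_int_of_zero (h : IsRefinable N m L Φ) {ξ : ℝ} (h0 : Φ ξ = 0) :
    ∃ i : ℤ, m * ξ = N * i := by
  rcases h.zero_cases h0 with ⟨i, hi⟩ | hi
  · obtain ⟨t, rfl⟩ := h.N_dvd_m
    exact ⟨t * L * i, by rw [hi]; push_cast; ring⟩
  · exact hi

/-- The zeros of `Φ` are inherited by dividing by the base, off the zeros of the first mask. -/
theorem zero_of_zero_mul (h : IsRefinable N m L Φ) (δ : ℤ)
    (h0 : Φ (N * L * (δ / m)) = 0) (hδ : ¬ ∃ i : ℤ, (N : ℤ) * δ = m * i) : Φ (δ / m) = 0 := by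
  have hm := h.m_pos
  -- Since `m * (δ / m)` is an integer, the second mask equals 1 here.
  rw [h.refine, mul_div_cancel₀ _ hm.ne', digitMask_int h.L_ne, mul_one] at h0
  rcases mul_eq_zero.1 h0 with h1 | h1
  · exfalso
    obtain ⟨⟨i, hi⟩, -⟩ := digitMask_eq_zero h.N_ne h1
    refine hδ ⟨i, ?_⟩
    have : (((N : ℤ) * δ : ℤ) : ℝ) = ((m * i : ℤ) : ℝ) := by
      push_cast
      rw [← hi]
      field_simp
    exact_mod_cast this
  · exact h1

/-- The `ℤ`-periodization of `Φ`. -/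
def period (Φ : ℝ → ℝ) (ξ : ℝ) : ℝ := ∑' n : ℤ, Φ (ξ + n)

theorem period_add_int (Φ : ℝ → ℝ) (ξ : ℝ) (j : ℤ) : period Φ (ξ + j) = period Φ ξ := by
  unfold period
  rw [← (Equiv.addRight j).tsum_eq (fun n : ℤ => Φ (ξ + n))]
  refine tsum_congr fun n => ?_
  simp only [Equiv.coe_addRight, Int.cast_add]
  congr 1
  ring

theorem period_nonneg (h : IsRefinable N m L Φ) (ξ : ℝ) : 0 ≤ period Φ ξ :=
  tsum_nonneg fun _ => h.nonneg _

theorem le_period (h : IsRefinable N m L Φ) (ξ : ℝ) (n : ℤ) : Φ (ξ + n) ≤ period Φ ξ :=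
  (h.summable ξ).le_tsum n fun _ _ => h.nonneg _

/-- Split the summation index by its residue modulo `N * L`; both masks are 1-periodic, so they
depend on the residue only. -/
theorem period_eq_sum_base (h : IsRefinable N m L Φ) (ξ : ℝ) :
    period Φ ξ = ∑ i ∈ Finset.range (L * N), digitMask N ((ξ + i) / (N * L)) *
      digitMask L (m * ((ξ + i) / (N * L))) * period Φ ((ξ + i) / (N * L)) := by
  have hb : (N * L : ℝ) ≠ 0 := by have := h.base_gt_one; positivity
  have hN := h.N_pos
  have hL := h.L_pos
  have : NeZero (L * N) := ⟨mul_ne_zero h.L_ne h.N_ne⟩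
  have hs := h.summable ξ
  unfold period
  rw [← (Int.divModEquiv (L * N)).symm.tsum_eq]
  have hs' := (Int.divModEquiv (L * N)).symm.summable_iff.2 hs
  rw [← (Equiv.prodComm _ _).tsum_eq]
  have hs'' : Summable fun c : Fin (L * N) × ℤ =>
      Φ (ξ + ((Int.divModEquiv (L * N)).symm (Equiv.prodComm (Fin (L * N)) ℤ c) : ℤ)) :=
    (Equiv.prodComm _ _).summable_iff.2 hs'
  rw [hs''.tsum_prod, tsum_fintype, ← Fin.sum_univ_eq_sum_range (fun i : ℕ =>
    digitMask N ((ξ + i) / (N * L)) * digitMask L (m * ((ξ + i) / (N * L))) *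
      ∑' n : ℤ, Φ ((ξ + i) / (N * L) + n))]
  refine Finset.sum_congr rfl fun i _ => ?_
  rw [← tsum_mul_left]
  refine tsum_congr fun n => ?_
  simp only [Equiv.prodComm_apply, Prod.swap_prod_mk, Int.divModEquiv_symm_apply]
  have e1 : (ξ + ((n * (L * N : ℕ) + (i : ℕ) : ℤ) : ℝ)) / (N * L) = (ξ + (i : ℕ)) / (N * L) + n := by
    push_cast
    field_simp
    ring
  have e2 : (m : ℝ) * ((ξ + (i : ℕ)) / (N * L) + n) =
      m * ((ξ + (i : ℕ)) / (N * L)) + ((m * n : ℤ) : ℝ) := by push_cast; ring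
  have := h.refine_div (ξ + ((n * (L * N : ℕ) + (i : ℕ) : ℤ) : ℝ))
  rw [e1, e2, digitMask_add_int, digitMask_add_int] at this
  convert this using 2

/-- Writing residues as `i + L * a` shifts the argument by `a / N`. Because `N ∣ m`, the second mask
does not see this shift, and the inner sum over `a` becomes an average with weights summing to 1. -/
theorem period_eq_sum (h : IsRefinable N m L Φ) (ξ : ℝ) :
    period Φ ξ = ∑ i ∈ Finset.range L, digitMask L (m * ((ξ + i) / (N * L))) *
      ∑ a ∈ Finset.range N, digitMask N ((ξ + i) / (N * L) + a / N) *
        period Φ ((ξ + i) / (N * L) + a / N) := by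
  have hN := h.N_pos
  have hL := h.L_pos
  obtain ⟨t, ht⟩ := h.N_dvd_m
  have hconv : ∀ g : ℕ → ℝ, ∑ i ∈ Finset.range (L * N), g i =
      ∑ i ∈ Finset.range L, ∑ a ∈ Finset.range N, g (i + L * a) := by
    intro g
    rw [Finset.sum_comm]
    clear ht hN h
    induction N with
    | zero => simp
    | succ N ih => rw [mul_add_one, Finset.sum_range_add, ih, Finset.sum_range_succ]; simp [add_comm]
  rw [h.period_eq_sum_base, hconv]
  refine Finset.sum_congr rfl fun i _ => ?_
  rw [Finset.mul_sum]
  refine Finset.sum_congr rfl fun a _ => ?_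
  have e1 : (ξ + ((i + L * a : ℕ) : ℝ)) / (N * L) = (ξ + i) / (N * L) + a / N := by
    push_cast
    field_simp
    ring
  have e2 : (m : ℝ) * ((ξ + i) / (N * L) + a / N) =
      m * ((ξ + i) / (N * L)) + ((t * a : ℤ) : ℝ) := by
    rw [ht]; push_cast; field_simp
  rw [e1, e2, digitMask_add_int]
  ring

end IsRefinable

end

/-! ### Maximal orthogonal sets and the minimal spectral sum. -/

noncomputable section

/-- If every section of a family of finite weighted averages has sum at least `M`, then so does
the sum of the averages; the excess controls any section through a prescribed value. -/
theorem exists_section_le_sum_average {ι : Type*} [DecidableEq ι] (I : Finset ι) (A : Finset ℕ)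
    (w v : ι → ℕ → ℝ) (hw : ∀ i a, 0 ≤ w i a) (hw1 : ∀ i, ∑ a ∈ A, w i a = 1) (M : ℝ)
    (hM : ∀ c : ι → ℕ, M ≤ ∑ i ∈ I, v i (c i)) {j : ι} (hj : j ∈ I) {β : ℕ} (hβ : β ∈ A) :
    ∃ c : ι → ℕ, c j = β ∧ w j β * ∑ i ∈ I, v i (c i) + (1 - w j β) * M ≤
      ∑ i ∈ I, ∑ a ∈ A, w i a * v i a := by
  -- `c i` minimizes `v i` over `A`. The witness is this section with its value at `j` replaced by
  -- `β`: at `j`, weight `w j β` falls on `β` and the rest is bounded below by the minimum.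
  choose c hcA hc using fun i => A.exists_min_image (v i) ⟨β, hβ⟩
  have h1 : ∀ i, ∀ B ⊆ A, (∑ a ∈ B, w i a) * v i (c i) ≤ ∑ a ∈ B, w i a * v i a := by
    intro i B hB
    rw [Finset.sum_mul]
    exact Finset.sum_le_sum fun a ha => mul_le_mul_of_nonneg_left (hc i a (hB ha)) (hw i a)
  refine ⟨Function.update c j β, by simp, ?_⟩
  have h2 : ∑ i ∈ I, v i (Function.update c j β i) = v j β + ∑ i ∈ I.erase j, v i (c i) := by
    rw [← Finset.add_sum_erase _ _ hj]
    simp only [Function.update_self]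
    congr 1
    refine Finset.sum_congr rfl fun i hi => ?_
    rw [Function.update_of_ne (Finset.ne_of_mem_erase hi)]
  have h3 := hM c
  rw [← Finset.add_sum_erase _ _ hj] at h3
  have h4 : ∑ i ∈ I.erase j, v i (c i) ≤ ∑ i ∈ I.erase j, ∑ a ∈ A, w i a * v i a :=
    Finset.sum_le_sum fun i _ => by simpa [hw1] using h1 i A subset_rfl
  have h5 := h1 j (A.erase β) (Finset.erase_subset _ _)
  have h6 := hw1 j
  rw [← Finset.add_sum_erase _ _ hβ] at h6
  rw [h2, ← Finset.add_sum_erase _ _ hj, ← Finset.add_sum_erase _ _ hβ]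
  have h7 : 0 ≤ 1 - w j β := by
    have := Finset.sum_nonneg fun a (_ : a ∈ A.erase β) => hw j a
    linarith
  have h8 : ∑ a ∈ A.erase β, w j a = 1 - w j β := by linarith
  rw [h8] at h5
  have h9 := mul_le_mul_of_nonneg_left h3 h7
  linarith

namespace IsRefinable

variable {N m L : ℕ} {Φ : ℝ → ℝ}

/-- The exponentials with frequencies in `S / m + ℤ` are orthogonal. -/
def Orth (m : ℕ) (Φ : ℝ → ℝ) (S : Finset ℤ) : Prop :=
  ∀ k ∈ S, ∀ l ∈ S, k ≠ l → ∀ n : ℤ, Φ ((k - l : ℤ) / m + n) = 0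

/-- Otherwise an integer shift would bring the difference to 0, where Φ equals 1. Hence elements of
`S` are distinct modulo `m`, which bounds the cardinality. -/
theorem Orth.eq_of_dvd (h : IsRefinable N m L Φ) {S : Finset ℤ} (hS : Orth m Φ S) {k l : ℤ}
    (hk : k ∈ S) (hl : l ∈ S) (hd : (m : ℤ) ∣ k - l) : k = l := by
  by_contra hne
  obtain ⟨j, hj⟩ := hd
  have := hS k hk l hl hne (-j)
  have hm := h.m_pos
  rw [hj] at this
  push_cast at this
  rw [mul_div_cancel_left₀ _ hm.ne', add_neg_cancel, h.zero] at this
  exact one_ne_zero this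

theorem Orth.card_le (h : IsRefinable N m L Φ) {S : Finset ℤ} (hS : Orth m Φ S) :
    S.card ≤ m := by
  have hm : (m : ℤ) ≠ 0 := by have := h.one_le_m; omega
  have hm' : (0 : ℤ) < m := by have := h.one_le_m; omega
  have h1 : S.card ≤ (Finset.Ico (0 : ℤ) m).card := by
    refine Finset.card_le_card_of_injOn (fun k => k % m) ?_ ?_
    · intro k _
      simp only [Finset.coe_Ico, Set.mem_Ico]
      exact ⟨Int.emod_nonneg _ hm, Int.emod_lt_of_pos _ hm'⟩
    · intro k hk l hl hkl
      exact hS.eq_of_dvd h hk hl (Int.ModEq.dvd (Int.ModEq.symm hkl))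
  simpa using h1

/-- Orthogonal sets of maximal cardinality. -/
def MaxOrth (m : ℕ) (Φ : ℝ → ℝ) (S : Finset ℤ) : Prop :=
  Orth m Φ S ∧ ∀ R, Orth m Φ R → R.card ≤ S.card

theorem exists_maxOrth (h : IsRefinable N m L Φ) : ∃ S, MaxOrth m Φ S := by
  classical
  let P : ℕ → Prop := fun c => ∃ S, Orth m Φ S ∧ S.card = c
  have h0 : P 0 := ⟨∅, by simp [Orth], rfl⟩
  obtain ⟨S, hS, hc⟩ := Nat.findGreatest_spec (P := P) (Nat.zero_le m) h0
  refine ⟨S, hS, fun R hR => ?_⟩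
  rw [hc]
  exact Nat.le_findGreatest (hR.card_le h) ⟨R, hR, rfl⟩

/-- Maximality refers to cardinality rather than inclusion, so that counting suffices to transfer it
to sets constructed from `S`. -/
theorem MaxOrth.of_card {S R : Finset ℤ} (hS : MaxOrth m Φ S) (hR : Orth m Φ R)
    (hc : S.card ≤ R.card) : MaxOrth m Φ R :=
  ⟨hR, fun Q hQ => (hS.2 Q hQ).trans hc⟩

theorem MaxOrth.card_pos {S : Finset ℤ} (hS : MaxOrth m Φ S) : 0 < S.card := by
  have := hS.2 {0} (by simp [Orth])
  simpa using this

/-- The sum of `Φ` over the translate of `S / m + ℤ` by `ξ`. -/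
def spectralSum (m : ℕ) (Φ : ℝ → ℝ) (S : Finset ℤ) (ξ : ℝ) : ℝ :=
  ∑ k ∈ S, period Φ (ξ + k / m)

theorem le_spectralSum (h : IsRefinable N m L Φ) {S : Finset ℤ} {k : ℤ} (hk : k ∈ S) (ξ : ℝ) :
    Φ (ξ + k / m) ≤ spectralSum m Φ S ξ := by
  have h1 := h.le_period (ξ + k / m) 0
  rw [Int.cast_zero, add_zero] at h1
  exact h1.trans (Finset.single_le_sum (f := fun k : ℤ => period Φ (ξ + k / m))
    (fun i _ => h.period_nonneg _) hk)

theorem MaxOrth.translate {S : Finset ℤ} (hS : MaxOrth m Φ S) (j : ℤ) :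
    MaxOrth m Φ (S.image (· - j)) := by
  have hinj : Function.Injective (fun k : ℤ => k - j) := sub_left_injective
  refine hS.of_card ?_ (Finset.card_image_of_injective _ hinj).ge
  intro k hk l hl hkl n
  obtain ⟨k, hk', rfl⟩ := Finset.mem_image.1 hk
  obtain ⟨l, hl', rfl⟩ := Finset.mem_image.1 hl
  rw [sub_sub_sub_cancel_right]
  exact hS.1 k hk' l hl' (fun e => hkl (by rw [e])) n

theorem spectralSum_translate (S : Finset ℤ) (j : ℤ) (ξ : ℝ) :
    spectralSum m Φ (S.image (· - j)) (ξ + j / m) = spectralSum m Φ S ξ := by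
  have hinj : Function.Injective (fun k : ℤ => k - j) := sub_left_injective
  unfold spectralSum
  rw [Finset.sum_image hinj.injOn]
  refine Finset.sum_congr rfl fun k _ => ?_
  congr 1
  push_cast
  ring

/-- Positivity: a maximal orthogonal set cannot be enlarged by a frequency. -/
theorem MaxOrth.exists_ne_zero (h : IsRefinable N m L Φ) {S : Finset ℤ} (hS : MaxOrth m Φ S)
    (ξ : ℝ) : ∃ k ∈ S, ∃ n : ℤ, Φ (ξ + k / m + n) ≠ 0 := by
  by_contra! h0
  have hm := h.m_pos
  obtain ⟨k₀, hk₀⟩ := Finset.card_pos.1 hS.card_pos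
  -- A single zero already places `ξ` in `(1/m)ℤ`, say `ξ = -y/m`; then `y` could be adjoined to
  -- `S`.
  obtain ⟨i, hi⟩ := h.exists_int_of_zero (h0 k₀ hk₀ 0)
  obtain ⟨y, hy⟩ : ∃ y : ℤ, ξ = -((y : ℝ) / m) := by
    refine ⟨k₀ - N * i, ?_⟩
    push_cast
    rw [← hi]
    field_simp
    push_cast
    ring
  subst hy
  have h1 : ∀ k ∈ S, ∀ n : ℤ, Φ ((k - y : ℤ) / m + n) = 0 := by
    intro k hk n
    rw [← h0 k hk n]
    push_cast
    ring_nf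
  have hy : y ∉ S := by
    intro hy
    have := h1 y hy 0
    simp [h.zero] at this
  have h2 : Orth m Φ (insert y S) := by
    intro k hk l hl hkl n
    rcases Finset.mem_insert.1 hk with rfl | hk'
    · rcases Finset.mem_insert.1 hl with rfl | hl'
      · exact absurd rfl hkl
      · rw [← h.neg, ← h1 l hl' (-n)]
        push_cast
        ring_nf
    · rcases Finset.mem_insert.1 hl with rfl | hl'
      · exact h1 k hk' n
      · exact hS.1 k hk' l hl' hkl n
  have := hS.2 _ h2
  rw [Finset.card_insert_of_notMem hy] at this
  omega

/-- The minimum of the spectral sums over all maximal orthogonal sets is attained. -/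
theorem exists_min_spectralSum (h : IsRefinable N m L Φ) :
    ∃ S ξ, MaxOrth m Φ S ∧ ∀ R η, MaxOrth m Φ R → spectralSum m Φ S ξ ≤ spectralSum m Φ R η := by
  classical
  have hm : (m : ℤ) ≠ 0 := by have := h.one_le_m; omega
  have hm' : (0 : ℤ) < m := by have := h.one_le_m; omega
  have hmr := h.m_pos
  -- Only frequencies modulo 1 matter, so finitely many candidate sets suffice.
  let J : Finset (Finset ℤ) := (Finset.Ico (0 : ℤ) m).powerset.filter (MaxOrth m Φ)
  -- reduction of the frequencies modulo one
  have hred : ∀ R, MaxOrth m Φ R → ∀ η, ∃ R' ∈ J, spectralSum m Φ R η = spectralSum m Φ R' η := by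
    intro R hR η
    have hinj : Set.InjOn (fun k : ℤ => k % m) R := fun k hk l hl hkl =>
      hR.1.eq_of_dvd h hk hl (Int.ModEq.dvd (Int.ModEq.symm hkl))
    have hmod : ∀ k : ℤ, ((k % m : ℤ) : ℝ) = k - m * (k / m : ℤ) := by
      intro k
      rw [Int.emod_def]
      push_cast
      ring
    refine ⟨R.image (fun k => k % m), ?_, ?_⟩
    · refine Finset.mem_filter.2 ⟨?_, ?_⟩
      · rw [Finset.mem_powerset]
        intro x hx
        obtain ⟨k, -, rfl⟩ := Finset.mem_image.1 hx
        exact Finset.mem_Ico.2 ⟨Int.emod_nonneg _ hm, Int.emod_lt_of_pos _ hm'⟩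
      · refine hR.of_card ?_ (Finset.card_image_of_injOn hinj).ge
        intro k hk l hl hkl n
        obtain ⟨k, hk', rfl⟩ := Finset.mem_image.1 hk
        obtain ⟨l, hl', rfl⟩ := Finset.mem_image.1 hl
        rw [← hR.1 k hk' l hl' (fun e => hkl (by rw [e])) (n - (k / m : ℤ) + (l / m : ℤ))]
        congr 1
        push_cast [hmod]
        field_simp
        ring
    · unfold spectralSum
      rw [Finset.sum_image hinj]
      refine Finset.sum_congr rfl fun k _ => ?_
      rw [← period_add_int Φ (η + (k % m : ℤ) / m) (k / m : ℤ)]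
      congr 1
      rw [hmod]
      field_simp
      ring
  -- A series of nonnegative continuous functions is lower semicontinuous without any uniform
  -- convergence, and this is enough for a minimum on the compact interval [0, 1].
  have hlsc : ∀ R, LowerSemicontinuous fun ξ => ENNReal.ofReal (spectralSum m Φ R ξ) := by
    intro R
    have : (fun ξ => ENNReal.ofReal (spectralSum m Φ R ξ)) =
        fun ξ => ∑ k ∈ R, ∑' n : ℤ, ENNReal.ofReal (Φ (ξ + k / m + n)) := by
      funext ξ
      unfold spectralSum
      rw [ENNReal.ofReal_sum_of_nonneg fun k _ => h.period_nonneg _]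
      refine Finset.sum_congr rfl fun k _ => ?_
      rw [period, ENNReal.ofReal_tsum_of_nonneg (fun _ => h.nonneg _) (h.summable _)]
    rw [this]
    refine lowerSemicontinuous_sum fun k _ => lowerSemicontinuous_tsum fun n => ?_
    have := h.continuous
    exact (ENNReal.continuous_ofReal.comp (by fun_prop)).lowerSemicontinuous
  choose x hx hxmin using fun R => LowerSemicontinuousOn.exists_isMinOn
    (Set.nonempty_Icc.2 (zero_le_one (α := ℝ))) isCompact_Icc ((hlsc R).lowerSemicontinuousOn _)
  obtain ⟨S₀, hS₀⟩ := h.exists_maxOrth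
  obtain ⟨S₁, hS₁, -⟩ := hred S₀ hS₀ 0
  obtain ⟨S, hS, hmin⟩ := J.exists_min_image (fun R => spectralSum m Φ R (x R)) ⟨S₁, hS₁⟩
  refine ⟨S, x S, (Finset.mem_filter.1 hS).2, fun R η hR => ?_⟩
  obtain ⟨R', hR', e⟩ := hred R hR η
  rw [e]
  refine (hmin R' hR').trans ?_
  have e2 : spectralSum m Φ R' η = spectralSum m Φ R' (Int.fract η) := by
    unfold spectralSum
    refine Finset.sum_congr rfl fun k _ => ?_
    rw [← period_add_int Φ (Int.fract η + k / m) ⌊η⌋]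
    congr 1
    conv_lhs => rw [← Int.fract_add_floor η]
    ring
  rw [e2]
  have h3 := hxmin R' (show Int.fract η ∈ Set.Icc (0 : ℝ) 1 from
    ⟨Int.fract_nonneg _, (Int.fract_lt_one _).le⟩)
  exact (ENNReal.ofReal_le_ofReal_iff (Finset.sum_nonneg fun k _ => h.period_nonneg _)).1 h3

end IsRefinable

end

/-! ### Fibers over residues and the descent to the origin. -/

noncomputable section

namespace IsRefinable

variable {N m L : ℕ} {Φ : ℝ → ℝ}

/-- The residue `κ` in the decomposition `k + m i = N (κ + L z)`. -/
def fiberRes (N m L : ℕ) (p : ℤ × ℕ) : ℕ := (((p.1 + m * p.2) / N) % L).toNat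

/-- The quotient `z` in the decomposition `k + m i = N (κ + L z)`. -/
def fiberQuot (N m L : ℕ) (p : ℤ × ℕ) : ℤ := (p.1 + m * p.2) / N / L

/-- The pairs `(k, i)` with `k ∈ S`, `i < L` and residue `κ`. -/
def fiber (N m L : ℕ) (S : Finset ℤ) (κ : ℕ) : Finset (ℤ × ℕ) :=
  (S ×ˢ Finset.range L).filter fun p => fiberRes N m L p = κ

theorem fiberRes_lt (h : IsRefinable N m L Φ) (p : ℤ × ℕ) : fiberRes N m L p < L := by
  have hL : (0 : ℤ) < L := by have := h.two_le_L; omega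
  have h1 := Int.emod_lt_of_pos ((p.1 + m * p.2) / N) hL
  have h2 := Int.emod_nonneg ((p.1 + m * p.2) / N) hL.ne'
  unfold fiberRes
  omega

theorem N_dvd_of_mem (h : IsRefinable N m L Φ) {S : Finset ℤ} (hS : Orth m Φ S) (h0 : 0 ∈ S)
    {k : ℤ} (hk : k ∈ S) : (N : ℤ) ∣ k := by
  rcases eq_or_ne k 0 with rfl | hne
  · exact dvd_zero _
  · have h1 := hS k hk 0 h0 hne 0
    obtain ⟨i, hi⟩ := h.exists_int_of_zero h1
    refine ⟨i, ?_⟩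
    have hm := h.m_pos
    push_cast at hi
    rw [sub_zero, add_zero, mul_div_cancel₀ _ hm.ne'] at hi
    exact_mod_cast hi

/-- Dividing by `m * N * L` shows that `(ξ + k/m + i)/(NL)` is a base point depending only on the
residue `κ`, shifted by `z/m`. The quotients `z` over one residue thus act as a new set of
frequencies. -/
theorem fiber_eq (h : IsRefinable N m L Φ) {S : Finset ℤ} (hS : Orth m Φ S) (h0 : 0 ∈ S)
    {p : ℤ × ℕ} (hp : p.1 ∈ S) :
    p.1 + m * p.2 = N * (fiberRes N m L p + L * fiberQuot N m L p) := by
  have hL : (0 : ℤ) < L := by have := h.two_le_L; omega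
  have h1 : (N : ℤ) ∣ p.1 + m * p.2 :=
    dvd_add (h.N_dvd_of_mem hS h0 hp)
      (Dvd.dvd.mul_right (Int.natCast_dvd_natCast.2 h.N_dvd_m) _)
  have h2 := Int.emod_nonneg ((p.1 + m * p.2) / N) hL.ne'
  rw [fiberRes, fiberQuot, Int.toNat_of_nonneg h2, Int.emod_add_mul_ediv, Int.mul_ediv_cancel' h1]

/-- Distinct points of a fiber give orthogonal frequencies, for every choice of a section. -/
theorem fiber_orth (h : IsRefinable N m L Φ) {S : Finset ℤ} (hS : Orth m Φ S) (h0 : 0 ∈ S)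
    {t : ℕ} (ht : m = N * t) {p r : ℤ × ℕ} (hp : p ∈ S ×ˢ Finset.range L)
    (hr : r ∈ S ×ˢ Finset.range L) (hpr : fiberRes N m L p = fiberRes N m L r) (hne : p ≠ r)
    (c d n : ℤ) :
    Φ (((fiberQuot N m L p + t * c) - (fiberQuot N m L r + t * d) : ℤ) / m + n) = 0 := by
  have hm := h.m_pos
  have hm0 : (m : ℤ) ≠ 0 := by have := h.one_le_m; omega
  rw [Finset.mem_product, Finset.mem_range] at hp hr
  have e1 := h.fiber_eq hS h0 hp.1
  have e2 := h.fiber_eq hS h0 hr.1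
  rw [hpr] at e1
  set u := fiberQuot N m L p
  set v := fiberQuot N m L r
  set δ : ℤ := (u + t * c) - (v + t * d) + m * n with hδ
  -- Multiplication by the base returns `δ` to a difference of elements of `S`, up to a multiple of
  -- `m`.
  have hb : (N * L : ℤ) * δ = (p.1 - r.1) + m * ((p.2 - r.2) + L * (c - d) + N * L * n) := by
    have e3 : (N * L : ℤ) * (u - v) = (p.1 - r.1) + m * (p.2 - r.2) := by linear_combination e2 - e1
    have e4 : (m : ℤ) = N * t := by exact_mod_cast ht
    rw [hδ]
    linear_combination e3 - L * (c - d) * e4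
  -- Reduction modulo `m` would force equal first entries, and then the second entries, both below
  -- `L`, would agree modulo `L`. This gives both a zero of Φ at `N * L * δ / m` and the
  -- non-integrality of `N * δ / m`.
  have hkey : ∀ j : ℤ, p.1 - r.1 + m * ((p.2 : ℤ) - r.2) ≠ m * L * j := by
    intro j hj
    have h1 : p.1 = r.1 := hS.eq_of_dvd h hp.1 hr.1 ⟨L * j - (p.2 - r.2), by linear_combination hj⟩
    rw [h1, sub_self, zero_add, mul_assoc] at hj
    have h2 := mul_left_cancel₀ hm0 hj
    have h3 := Int.eq_zero_of_abs_lt_dvd (Dvd.intro _ h2.symm) (by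
      rw [abs_lt]; constructor <;> omega)
    exact hne (Prod.ext h1 (by omega))
  have hz : Φ ((δ : ℝ) / m) = 0 := by
    refine h.zero_of_zero_mul δ ?_ ?_
    · have e5 : (N * L : ℝ) * ((δ : ℝ) / m) = ((p.1 - r.1 : ℤ) : ℝ) / m +
          (((p.2 - r.2) + L * (c - d) + N * L * n : ℤ) : ℝ) := by
        have : (((N * L : ℤ) * δ : ℤ) : ℝ) =
            (((p.1 - r.1) + m * ((p.2 - r.2) + L * (c - d) + N * L * n) : ℤ) : ℝ) := by rw [hb]
        push_cast at this ⊢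
        rw [mul_div_assoc', this]
        field_simp
      rw [e5]
      rcases eq_or_ne p.1 r.1 with h1 | h1
      · rw [h1, sub_self, Int.cast_zero, zero_div, zero_add]
        refine h.int _ fun h2 => hkey (-(c - d) - N * n) ?_
        rw [h1]
        linear_combination (m : ℤ) * h2
      · exact hS _ hp.1 _ hr.1 h1 _
    · rintro ⟨j, hj⟩
      refine hkey (j - (c - d) - N * n) ?_
      linear_combination (L : ℤ) * hj - hb
  rw [← hz, hδ]
  push_cast
  congr 1
  field_simp

theorem fiber_injOn (h : IsRefinable N m L Φ) {S : Finset ℤ} (hS : Orth m Φ S) (h0 : 0 ∈ S)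
    {t : ℕ} (ht : m = N * t) (κ : ℕ) (c : ℤ × ℕ → ℕ) :
    Set.InjOn (fun p => fiberQuot N m L p + t * c p) (fiber N m L S κ) := by
  intro p hp r hr hpr
  by_contra hne
  obtain ⟨hp, hp'⟩ := Finset.mem_filter.1 (Finset.mem_coe.1 hp)
  obtain ⟨hr, hr'⟩ := Finset.mem_filter.1 (Finset.mem_coe.1 hr)
  have := h.fiber_orth hS h0 ht hp hr (hp'.trans hr'.symm) hne (c p) (c r) 0
  simp only at hpr
  rw [hpr] at this
  simp [h.zero] at this

/-- The frequencies obtained from a fiber and a section. -/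
def fiberSet (N m L : ℕ) (S : Finset ℤ) (t κ : ℕ) (c : ℤ × ℕ → ℕ) : Finset ℤ :=
  (fiber N m L S κ).image fun p => fiberQuot N m L p + t * c p

theorem orth_fiberSet (h : IsRefinable N m L Φ) {S : Finset ℤ} (hS : Orth m Φ S) (h0 : 0 ∈ S)
    {t : ℕ} (ht : m = N * t) (κ : ℕ) (c : ℤ × ℕ → ℕ) :
    Orth m Φ (fiberSet N m L S t κ c) := by
  intro k hk l hl hkl n
  obtain ⟨p, hp, rfl⟩ := Finset.mem_image.1 hk
  obtain ⟨r, hr, rfl⟩ := Finset.mem_image.1 hl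
  obtain ⟨hp, hp'⟩ := Finset.mem_filter.1 hp
  obtain ⟨hr, hr'⟩ := Finset.mem_filter.1 hr
  exact h.fiber_orth hS h0 ht hp hr (hp'.trans hr'.symm) (fun e => hkl (by rw [e])) _ _ _

/-- Each fiber yields an orthogonal set, so it has at most `S.card` elements. The `L` fibers
partition a set of `L * S.card` pairs, so equality holds in each. -/
theorem card_fiber (h : IsRefinable N m L Φ) {S : Finset ℤ} (hS : MaxOrth m Φ S) (h0 : 0 ∈ S)
    {κ : ℕ} (hκ : κ ∈ Finset.range L) : (fiber N m L S κ).card = S.card := by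
  obtain ⟨t, ht⟩ := h.N_dvd_m
  have hle : ∀ κ ∈ Finset.range L, (fiber N m L S κ).card ≤ S.card := by
    intro κ _
    have h1 := hS.2 _ (h.orth_fiberSet hS.1 h0 ht κ fun _ => 0)
    rwa [fiberSet, Finset.card_image_of_injOn (h.fiber_injOn hS.1 h0 ht κ fun _ => 0)] at h1
  have hsum : ∑ κ ∈ Finset.range L, (fiber N m L S κ).card = ∑ κ ∈ Finset.range L, S.card := by
    have := Finset.card_eq_sum_card_fiberwise (f := fiberRes N m L) (s := S ×ˢ Finset.range L)
      (t := Finset.range L) fun p _ => by simpa using h.fiberRes_lt p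
    unfold fiber
    rw [← this]
    simp [mul_comm]
  exact (Finset.sum_eq_sum_iff_of_le hle).1 hsum κ hκ

theorem maxOrth_fiberSet (h : IsRefinable N m L Φ) {S : Finset ℤ} (hS : MaxOrth m Φ S)
    (h0 : 0 ∈ S) {t : ℕ} (ht : m = N * t) {κ : ℕ} (hκ : κ ∈ Finset.range L) (c : ℤ × ℕ → ℕ) :
    MaxOrth m Φ (fiberSet N m L S t κ c) := by
  refine hS.of_card (h.orth_fiberSet hS.1 h0 ht κ c) ?_
  rw [fiberSet, Finset.card_image_of_injOn (h.fiber_injOn hS.1 h0 ht κ c), h.card_fiber hS h0 hκ]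

/-- Since `t / m = 1 / N`, choosing a section amounts to choosing one term `a` of each inner
average. -/
theorem spectralSum_fiberSet (h : IsRefinable N m L Φ) {S : Finset ℤ} (hS : MaxOrth m Φ S)
    (h0 : 0 ∈ S) {t : ℕ} (ht : m = N * t) (κ : ℕ) (c : ℤ × ℕ → ℕ) (ξ : ℝ) :
    spectralSum m Φ (fiberSet N m L S t κ c) ξ =
      ∑ p ∈ fiber N m L S κ, period Φ (ξ + fiberQuot N m L p / m + c p / N) := by
  have hN := h.N_pos
  have hm := h.m_pos
  have htr : (m : ℝ) = N * t := by exact_mod_cast ht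
  have ht0 : (t : ℝ) ≠ 0 := by
    intro h1; rw [h1, mul_zero] at htr; exact hm.ne' htr
  rw [spectralSum, fiberSet, Finset.sum_image (h.fiber_injOn hS.1 h0 ht κ c)]
  refine Finset.sum_congr rfl fun p _ => ?_
  congr 1
  push_cast
  rw [htr]
  field_simp
  ring

/-- The weights sum to 1 over `κ`, and the inner ones to 1 over `a`. This exhibits the sum as an
average over residues and sections. -/
theorem spectralSum_eq_sum_fiber (h : IsRefinable N m L Φ) {S : Finset ℤ} (hS : MaxOrth m Φ S)
    (h0 : 0 ∈ S) (ξ : ℝ) :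
    spectralSum m Φ S ξ = ∑ κ ∈ Finset.range L, digitMask L (m * ξ / (N * L) + κ / L) *
      ∑ p ∈ fiber N m L S κ, ∑ a ∈ Finset.range N,
        digitMask N ((ξ + N * κ / m) / (N * L) + fiberQuot N m L p / m + a / N) *
          period Φ ((ξ + N * κ / m) / (N * L) + fiberQuot N m L p / m + a / N) := by
  have hN := h.N_pos
  have hL := h.L_pos
  have hm := h.m_pos
  unfold spectralSum
  rw [Finset.sum_congr rfl fun (k : ℤ) _ => h.period_eq_sum (ξ + (k : ℝ) / m),
    ← Finset.sum_product',
    ← Finset.sum_fiberwise_of_maps_to (g := fiberRes N m L) (t := Finset.range L)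
      (fun p _ => Finset.mem_range.2 (h.fiberRes_lt p))]
  refine Finset.sum_congr rfl fun κ _ => ?_
  rw [Finset.mul_sum]
  refine Finset.sum_congr rfl fun p hp => ?_
  obtain ⟨hp, hp'⟩ := Finset.mem_filter.1 hp
  have e1 := h.fiber_eq hS.1 h0 (Finset.mem_product.1 hp).1
  rw [hp'] at e1
  have e2 : (p.1 : ℝ) + m * p.2 = N * (κ + L * fiberQuot N m L p) := by exact_mod_cast e1
  have e3 : (ξ + (p.1 : ℝ) / m + p.2) / (N * L) =
      (ξ + N * κ / m) / (N * L) + fiberQuot N m L p / m := by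
    field_simp
    linear_combination e2
  have e4 : (m : ℝ) * ((ξ + N * κ / m) / (N * L) + fiberQuot N m L p / m) =
      m * ξ / (N * L) + κ / L + fiberQuot N m L p := by
    field_simp
  rw [e3, e4, digitMask_add_int]

/-- One step of the descent of a minimizer along division by the base. -/
theorem descent (h : IsRefinable N m L Φ) {M : ℝ}
    (hM : ∀ R η, MaxOrth m Φ R → M ≤ spectralSum m Φ R η) {S : Finset ℤ} (hS : MaxOrth m Φ S)
    (h0 : 0 ∈ S) {ξ : ℝ} (hξ : Φ ξ ≠ 0) (hSM : spectralSum m Φ S ξ ≤ M) :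
    ∃ R, MaxOrth m Φ R ∧ 0 ∈ R ∧ Φ (ξ / (N * L)) ≠ 0 ∧ spectralSum m Φ R (ξ / (N * L)) ≤ M := by
  have hN := h.N_pos
  have hL := h.L_pos
  have hm := h.m_pos
  obtain ⟨t, ht⟩ := h.N_dvd_m
  have hsec : ∀ κ ∈ Finset.range L, ∀ c : ℤ × ℕ → ℕ, M ≤ ∑ p ∈ fiber N m L S κ,
      period Φ ((ξ + N * κ / m) / (N * L) + fiberQuot N m L p / m + c p / N) := by
    intro κ hκ c
    rw [← h.spectralSum_fiberSet hS h0 ht]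
    exact hM _ _ (h.maxOrth_fiberSet hS h0 ht hκ c)
  have hrange : 0 ∈ Finset.range L := Finset.mem_range.2 (by have := h.two_le_L; omega)
  have hrangeN : 0 ∈ Finset.range N := Finset.mem_range.2 (by have := h.two_le_N; omega)
  -- This pair, taken with `a = 0`, leads exactly to the point `ξ / (N * L)`.
  have hmem : ((0, 0) : ℤ × ℕ) ∈ fiber N m L S 0 := by
    refine Finset.mem_filter.2 ⟨Finset.mem_product.2 ⟨h0, hrange⟩, ?_⟩
    simp [fiberRes]
  -- lower bound for a single residue, sharpened through a prescribed point
  have hlow : ∀ κ ∈ Finset.range L, ∀ j ∈ fiber N m L S κ, _ := fun κ hκ j hj =>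
    exists_section_le_sum_average (fiber N m L S κ) (Finset.range N)
      (fun p a => digitMask N ((ξ + N * κ / m) / (N * L) + fiberQuot N m L p / m + a / N))
      (fun p a => period Φ ((ξ + N * κ / m) / (N * L) + fiberQuot N m L p / m + a / N))
      (fun _ _ => digitMask_nonneg _ _) (fun _ => sum_digitMask h.N_ne _) M (hsec κ hκ) hj hrangeN
  have hge : ∀ κ ∈ Finset.range L, M ≤ ∑ p ∈ fiber N m L S κ, ∑ a ∈ Finset.range N,
        digitMask N ((ξ + N * κ / m) / (N * L) + fiberQuot N m L p / m + a / N) *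
          period Φ ((ξ + N * κ / m) / (N * L) + fiberQuot N m L p / m + a / N) := by
    intro κ hκ
    obtain ⟨j, hj⟩ : (fiber N m L S κ).Nonempty := by
      rw [← Finset.card_pos, h.card_fiber hS h0 hκ]
      exact hS.card_pos
    obtain ⟨c, -, hc⟩ := hlow κ hκ j hj
    refine le_trans ?_ hc
    have := mul_le_mul_of_nonneg_left (hsec κ hκ c) (digitMask_nonneg N
      ((ξ + N * κ / m) / (N * L) + fiberQuot N m L j / m + (0 : ℕ) / N))
    linarith
  obtain ⟨c, hc0, hc⟩ := hlow 0 hrange _ hmem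
  have hq : fiberQuot N m L (0, 0) = 0 := by simp [fiberQuot]
  rw [← h.spectralSum_fiberSet hS h0 ht 0 c, hq] at hc
  have hfac := h.refine_div ξ
  have e0 : (ξ + N * ((0 : ℕ) : ℝ) / m) / (N * L) = ξ / (N * L) := by simp
  rw [e0] at hc
  have e1 : ξ / (N * L) + ((0 : ℤ) : ℝ) / m + ((0 : ℕ) : ℝ) / N = ξ / (N * L) := by simp
  rw [e1] at hc
  refine ⟨fiberSet N m L S t 0 c, h.maxOrth_fiberSet hS h0 ht hrange c, ?_, ?_, ?_⟩
  · exact Finset.mem_image.2 ⟨(0, 0), hmem, by simp [hc0, hq]⟩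
  · intro hz
    rw [hz, mul_zero] at hfac
    exact hξ hfac
  · have hpos : 0 < digitMask N (ξ / (N * L)) * digitMask L (m * (ξ / (N * L))) := by
      refine lt_of_le_of_ne (mul_nonneg (digitMask_nonneg _ _) (digitMask_nonneg _ _)) fun hz => ?_
      rw [← hz, zero_mul] at hfac
      exact hξ hfac
    have htot := h.spectralSum_eq_sum_fiber hS h0 ξ
    rw [← Finset.add_sum_erase _ _ hrange] at htot
    have hmask := sum_digitMask h.L_ne (m * ξ / (N * L))
    rw [← Finset.add_sum_erase _ _ hrange] at hmask
    have hrest := Finset.sum_le_sum fun κ (hκ : κ ∈ (Finset.range L).erase 0) =>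
      mul_le_mul_of_nonneg_left (hge κ (Finset.mem_of_mem_erase hκ))
        (digitMask_nonneg L (m * ξ / (N * L) + κ / L))
    rw [← Finset.sum_mul] at hrest
    have e2 : (m : ℝ) * ξ / (N * L) + ((0 : ℕ) : ℝ) / L = m * (ξ / (N * L)) := by
      simp [mul_div_assoc]
    rw [e2] at htot hmask
    rw [e0] at htot
    have hfirst := mul_le_mul_of_nonneg_left hc (digitMask_nonneg L (m * (ξ / (N * L))))
    set W := digitMask N (ξ / (N * L))
    set U := digitMask L (m * (ξ / (N * L)))
    set X := spectralSum m Φ (fiberSet N m L S t 0 c) (ξ / (N * L))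
    have hfin : W * U * X ≤ W * U * M := by
      have e3 : ∑ x ∈ (Finset.range L).erase 0, digitMask L (m * ξ / (N * L) + x / L) = 1 - U := by
        linarith
      rw [e3] at hrest
      nlinarith
    exact le_of_mul_le_mul_left hfin hpos

/-- Along the descent 0 stays in the sets, so the minimal value dominates Φ at points tending to 0.
-/
theorem one_le_spectralSum (h : IsRefinable N m L Φ) :
    ∃ S, Orth m Φ S ∧ ∀ ξ, 1 ≤ spectralSum m Φ S ξ := by
  obtain ⟨S, ξ, hS, hmin⟩ := h.exists_min_spectralSum
  refine ⟨S, hS.1, fun η => le_trans ?_ (hmin S η hS)⟩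
  obtain ⟨k, hk, n, hkn⟩ := hS.exists_ne_zero h ξ
  -- move the frequency where `Φ` does not vanish to the origin
  have hstart : ∃ R, MaxOrth m Φ R ∧ 0 ∈ R ∧
      spectralSum m Φ R (ξ + k / m + n) ≤ spectralSum m Φ S ξ := by
    refine ⟨S.image (· - k), hS.translate k, Finset.mem_image.2 ⟨k, hk, sub_self k⟩, ?_⟩
    rw [← spectralSum_translate S k ξ]
    refine le_of_eq (Finset.sum_congr rfl fun l _ => ?_)
    rw [← period_add_int Φ (ξ + k / m + l / m) n]
    congr 1
    ring
  have hall : ∀ i : ℕ, ∃ R, MaxOrth m Φ R ∧ 0 ∈ R ∧ Φ ((ξ + k / m + n) / (N * L : ℝ) ^ i) ≠ 0 ∧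
      spectralSum m Φ R ((ξ + k / m + n) / (N * L : ℝ) ^ i) ≤ spectralSum m Φ S ξ := by
    intro i
    induction i with
    | zero =>
      obtain ⟨R, h1, h2, h3⟩ := hstart
      exact ⟨R, h1, h2, by simpa using hkn, by simpa using h3⟩
    | succ i ih =>
      obtain ⟨R, h1, h2, h3, h4⟩ := ih
      have := h.descent (fun R η hR => hmin R η hR) h1 h2 h3 h4
      rwa [div_div, ← pow_succ] at this
  refine le_of_tendsto (h.tendsto_div_pow (ξ + k / m + n)) (Filter.Eventually.of_forall fun i => ?_)
  obtain ⟨R, h1, h2, h3, h4⟩ := hall i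
  have := h.le_spectralSum h2 ((ξ + k / m + n) / (N * L : ℝ) ^ i)
  rw [Int.cast_zero, zero_div, add_zero] at this
  exact this.trans h4

end IsRefinable

end

/-! ### Digit sets of positive measure tile the line. -/

noncomputable section

/-- `T` is self-affine with integer base `b` and the finite family `d` of `b` integer digits. -/
structure IsDigitTile {ι : Type*} [Fintype ι] (b : ℕ) (d : ι → ℤ) (T : Set ℝ) : Prop where
  two_le : 2 ≤ b
  card_eq : Fintype.card ι = b
  isCompact : IsCompact T
  measure_ne_zero : volume T ≠ 0
  smul_eq : (b : ℝ) • T = ⋃ p, (d p : ℝ) +ᵥ T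

namespace IsDigitTile

variable {ι : Type*} [Fintype ι] {b : ℕ} {d : ι → ℤ} {T : Set ℝ}

theorem measurableSet (h : IsDigitTile b d T) : MeasurableSet T := h.isCompact.measurableSet

theorem measure_ne_top (h : IsDigitTile b d T) : volume T ≠ ⊤ := h.isCompact.measure_lt_top.ne

theorem measurableSet_vadd (h : IsDigitTile b d T) (x : ℝ) : MeasurableSet (x +ᵥ T) :=
  h.measurableSet.const_vadd x

theorem b_pos (h : IsDigitTile b d T) : (0 : ℝ) < b := by
  have := h.two_le
  exact_mod_cast (by omega : 0 < b)

theorem measure_smul (h : IsDigitTile b d T) (s : Set ℝ) :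
    volume ((b : ℝ) • s) = b * volume s := by
  rw [Measure.addHaar_smul]
  simp [abs_of_pos h.b_pos]

/-- The first-level pieces overlap in null sets. -/
theorem measure_inter_digit (h : IsDigitTile b d T) {p q : ι} (hpq : p ≠ q) :
    volume (((d p : ℝ) +ᵥ T) ∩ ((d q : ℝ) +ᵥ T)) = 0 := by
  classical
  set A : ι → Set ℝ := fun p => (d p : ℝ) +ᵥ T
  set B : Set ℝ := ⋃ r ∈ Finset.univ.erase p, A r
  have hA : ∀ r, volume (A r) = volume T := fun r => measure_vadd _ _ _
  have hU : A p ∪ B = (b : ℝ) • T := by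
    rw [h.smul_eq]
    ext x
    simp only [B, Set.mem_union, Set.mem_iUnion, Finset.mem_erase, Finset.mem_univ, and_true,
      exists_prop]
    constructor
    · rintro (hx | ⟨r, -, hx⟩)
      exacts [⟨p, hx⟩, ⟨r, hx⟩]
    · rintro ⟨r, hx⟩
      by_cases hr : r = p
      · exact Or.inl (hr ▸ hx)
      · exact Or.inr ⟨r, hr, hx⟩
  have hBm : MeasurableSet B := Finset.measurableSet_biUnion _ fun r _ => h.measurableSet_vadd _
  have hB : volume B ≤ (b - 1 : ℕ) * volume T := by
    refine (measure_biUnion_finset_le _ _).trans ?_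
    simp [hA, h.card_eq]
  -- The `b` pieces have total measure `b * volume T`, which is the measure of their union, so
  -- nothing is left for overlaps.
  have h1 := measure_union_add_inter (μ := volume) (A p) hBm
  rw [hU, h.measure_smul, hA] at h1
  have h2 : (b : ENNReal) * volume T + volume (A p ∩ B) ≤ b * volume T + 0 := by
    rw [h1, add_zero]
    calc volume T + volume B ≤ volume T + (b - 1 : ℕ) * volume T := by gcongr
      _ = ((1 + (b - 1) : ℕ) : ENNReal) * volume T := by push_cast; ring
      _ = b * volume T := by have := h.two_le; rw [show 1 + (b - 1) = b by omega]
  have h3 : volume (A p ∩ B) ≤ 0 :=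
    (ENNReal.add_le_add_iff_left (ENNReal.mul_ne_top (by simp) h.measure_ne_top)).1 h2
  refine measure_mono_null (Set.inter_subset_inter_right _ ?_) (nonpos_iff_eq_zero.1 h3)
  exact Set.subset_biUnion_of_mem (u := A) (by simpa using hpq.symm)

/-- The integers with a radix expansion of length `n` in base `b` with digits `d`. -/
def levelDigits (b : ℕ) (d : ι → ℤ) : ℕ → Set ℤ
  | 0 => {0}
  | n + 1 => {z | ∃ p, ∃ y ∈ levelDigits b d n, z = d p + b * y}

theorem smul_vadd_int (h : IsDigitTile b d T) (y : ℤ) :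
    (b : ℝ) • ((y : ℝ) +ᵥ T) = ⋃ p, ((d p + b * y : ℤ) : ℝ) +ᵥ T := by
  have h1 : (b : ℝ) • ((y : ℝ) +ᵥ T) = ((b * y : ℝ)) +ᵥ ((b : ℝ) • T) := by
    ext x
    simp only [Set.mem_smul_set, Set.mem_vadd_set, smul_eq_mul, vadd_eq_add]
    constructor
    · rintro ⟨_, ⟨z, hz, rfl⟩, rfl⟩
      exact ⟨_, ⟨z, hz, rfl⟩, by ring⟩
    · rintro ⟨_, ⟨z, hz, rfl⟩, rfl⟩
      exact ⟨_, ⟨z, hz, rfl⟩, by ring⟩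
  rw [h1, h.smul_eq, Set.vadd_set_iUnion]
  refine Set.iUnion_congr fun p => ?_
  rw [← add_vadd]
  push_cast
  rw [add_comm]

theorem pow_smul_eq (h : IsDigitTile b d T) (n : ℕ) :
    (b : ℝ) ^ n • T = ⋃ y ∈ levelDigits b d n, (y : ℝ) +ᵥ T := by
  induction n with
  | zero => simp [levelDigits]
  | succ n ih =>
    rw [pow_succ', mul_smul, ih, Set.smul_set_iUnion₂]
    simp only [h.smul_vadd_int]
    ext x
    simp only [Set.mem_iUnion, levelDigits, exists_prop]
    constructor
    · rintro ⟨y, hy, p, hx⟩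
      exact ⟨_, ⟨p, y, hy, rfl⟩, hx⟩
    · rintro ⟨_, ⟨p, y, hy, rfl⟩, hx⟩
      exact ⟨y, hy, p, hx⟩

/-- Pieces with the same parent `y` overlap as first-level pieces do; otherwise they lie in the
dilates of two different parents, covered by induction. -/
theorem measure_inter_level (h : IsDigitTile b d T) (n : ℕ) :
    ∀ y ∈ levelDigits b d n, ∀ z ∈ levelDigits b d n, y ≠ z →
      volume (((y : ℝ) +ᵥ T) ∩ ((z : ℝ) +ᵥ T)) = 0 := by
  induction n with
  | zero =>
    intro y hy z hz hyz
    exact absurd (hy.trans hz.symm) hyz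
  | succ n ih =>
    rintro _ ⟨p, y, hy, rfl⟩ _ ⟨q, z, hz, rfl⟩ hne
    by_cases hyz : y = z
    · subst hyz
      have hpq : p ≠ q := fun e => hne (by rw [e])
      have h1 : ∀ p, ((d p + b * y : ℤ) : ℝ) +ᵥ T = ((b * y : ℝ)) +ᵥ ((d p : ℝ) +ᵥ T) := by
        intro p
        rw [← add_vadd]
        push_cast
        rw [add_comm]
      rw [h1, h1, ← Set.vadd_set_inter, measure_vadd]
      exact h.measure_inter_digit hpq
    · have h1 : ∀ p y, ((d p + b * y : ℤ) : ℝ) +ᵥ T ⊆ (b : ℝ) • ((y : ℝ) +ᵥ T) := by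
        intro p y
        rw [h.smul_vadd_int]
        exact Set.subset_iUnion (fun p => ((d p + b * y : ℤ) : ℝ) +ᵥ T) p
      refine measure_mono_null (Set.inter_subset_inter (h1 p y) (h1 q z)) ?_
      rw [← Set.smul_set_inter₀ h.b_pos.ne', h.measure_smul, ih y hy z hz hyz, mul_zero]

/-- A set of positive measure with `b` integer digits in base `b` tiles the line. -/
theorem isTranslationTile (h : IsDigitTile b d T) : IsTranslationTile T := by
  have hb := h.b_pos
  obtain ⟨x, hx⟩ : ∃ x, Filter.Tendsto
      (fun r => volume (T ∩ Metric.closedBall x r) / volume (Metric.closedBall x r))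
      (nhdsWithin 0 (Set.Ioi 0)) (nhds 1) := by
    have h1 := Besicovitch.ae_tendsto_measure_inter_div volume T
    have : (ae (volume.restrict T)).NeBot := by
      rw [ae_neBot]
      simpa using h.measure_ne_zero
    exact h1.exists
  obtain ⟨C, hC⟩ := h.isCompact.isBounded.exists_norm_le
  -- `c n` recentres the blow-up at an integer near `b ^ n * x`. The ultrafilter then selects a
  -- limit of the sets `G n`, deciding membership of each integer.
  let c : ℕ → ℤ := fun n => ⌊(b : ℝ) ^ n * x⌋
  let G : ℕ → Set ℤ := fun n => {z | z + c n ∈ levelDigits b d n}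
  let U : Ultrafilter ℕ := Filter.hyperfilter ℕ
  let Γ : Set ℤ := {z | ∀ᶠ n in (U : Filter ℕ), z ∈ G n}
  have hvadd : ∀ n (z : ℤ), ((z + c n : ℤ) : ℝ) +ᵥ T = (c n : ℝ) +ᵥ ((z : ℝ) +ᵥ T) := by
    intro n z
    rw [← add_vadd]
    push_cast
    rw [add_comm]
  refine ⟨h.measurableSet.nullMeasurableSet, (fun z : ℤ => (z : ℝ)) '' Γ,
    (Set.to_countable Γ).image _, ?_, ?_⟩
  · rw [Set.biUnion_image]
    set V : Set ℝ := ⋃ z ∈ Γ, (z : ℝ) +ᵥ T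
    have hR : ∀ R : ℕ, volume (Metric.closedBall 0 R \ V) = 0 := by
      intro R
      -- The extra 1 in the radius absorbs the rounding in `c n`.
      let r : ℕ → ℝ := fun n => (R + 1) / (b : ℝ) ^ n
      let g : ℕ → ENNReal := fun n => ENNReal.ofReal (2 * (R + 1)) *
        (1 - volume (T ∩ Metric.closedBall x (r n)) / volume (Metric.closedBall x (r n)))
      have hrpos : ∀ n, 0 < r n := fun n => by positivity
      have hr : Filter.Tendsto r Filter.atTop (nhdsWithin 0 (Set.Ioi 0)) := by
        refine tendsto_nhdsWithin_iff.2 ⟨?_, Filter.Eventually.of_forall hrpos⟩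
        refine tendsto_const_nhds.div_atTop (tendsto_pow_atTop_atTop_of_one_lt ?_)
        have := h.two_le
        exact_mod_cast (by omega : 1 < b)
      have hg : Filter.Tendsto g Filter.atTop (nhds 0) := by
        have h1 := ENNReal.Tendsto.sub (tendsto_const_nhds (x := (1 : ENNReal))) (hx.comp hr)
          (Or.inl ENNReal.one_ne_top)
        have h2 := ENNReal.Tendsto.const_mul (a := ENNReal.ofReal (2 * (R + 1))) h1
          (Or.inr ENNReal.ofReal_ne_top)
        rw [tsub_self, mul_zero] at h2
        exact h2
      have hgeq : ∀ n, volume (Metric.closedBall ((b : ℝ) ^ n * x) (R + 1) \ (b : ℝ) ^ n • T) =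
          g n := by
        intro n
        have hbn : (0 : ℝ) < (b : ℝ) ^ n := by positivity
        have h1 : Metric.closedBall ((b : ℝ) ^ n * x) (R + 1) =
            (b : ℝ) ^ n • Metric.closedBall x (r n) := by
          rw [smul_closedBall' hbn.ne', Real.norm_of_nonneg hbn.le, smul_eq_mul]
          congr 1
          simp only [r]
          field_simp
        have hball : volume (Metric.closedBall x (r n)) = ENNReal.ofReal (2 * r n) :=
          Real.volume_closedBall _ _
        have hball0 : volume (Metric.closedBall x (r n)) ≠ 0 := by
          rw [hball]
          simpa using hrpos n
        have hballt : volume (Metric.closedBall x (r n)) ≠ ⊤ := by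
          rw [hball]
          exact ENNReal.ofReal_ne_top
        have h2 : volume (Metric.closedBall x (r n) \ T) = volume (Metric.closedBall x (r n)) *
            (1 - volume (T ∩ Metric.closedBall x (r n)) / volume (Metric.closedBall x (r n))) := by
          rw [ENNReal.mul_sub (fun _ _ => hballt), mul_one, ENNReal.mul_div_cancel hball0 hballt,
            ← Set.sdiff_inter_self_eq_sdiff, measure_sdiff Set.inter_subset_right
              (h.measurableSet.inter measurableSet_closedBall).nullMeasurableSet
              (measure_ne_top_of_subset Set.inter_subset_right hballt)]
        rw [h1, ← Set.smul_set_sdiff₀ hbn.ne', Measure.addHaar_smul, h2, hball, ← mul_assoc,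
          ← ENNReal.ofReal_mul (abs_nonneg _)]
        simp only [Module.finrank_self, pow_one, abs_of_pos hbn, g, hball]
        congr 2
        simp only [r]
        field_simp
      have hev : ∀ᶠ n in (U : Filter ℕ), volume (Metric.closedBall 0 R \ V) ≤ g n := by
        -- Only these finitely many translates can meet the ball of radius `R`, so ultrafilter-many
        -- `n` handle them simultaneously.
        have hfin : (Set.Icc (-⌈(R + C : ℝ)⌉) ⌈(R + C : ℝ)⌉).Finite := Set.finite_Icc _ _
        have h1 : ∀ᶠ n in (U : Filter ℕ), ∀ z ∈ Set.Icc (-⌈(R + C : ℝ)⌉) ⌈(R + C : ℝ)⌉,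
            z ∈ G n → z ∈ Γ := by
          rw [Filter.eventually_all_finite hfin]
          intro z _
          by_cases hz : z ∈ Γ
          · exact Filter.Eventually.of_forall fun n _ => hz
          · have : ∀ᶠ n in (U : Filter ℕ), ¬ z ∈ G n := Ultrafilter.eventually_not.2 hz
            exact this.mono fun n h1 h2 => absurd h2 h1
        refine h1.mono fun n hn => ?_
        rw [← hgeq n, ← measure_vadd volume (c n : ℝ) (Metric.closedBall 0 (R : ℝ) \ V)]
        refine measure_mono ?_
        rintro _ ⟨u, ⟨hu, huV⟩, rfl⟩
        simp only [vadd_eq_add]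
        refine ⟨?_, fun hmem => huV ?_⟩
        · rw [mem_closedBall_zero_iff, Real.norm_eq_abs, abs_le] at hu
          rw [Metric.mem_closedBall, Real.dist_eq, abs_le]
          have h2 := Int.floor_le ((b : ℝ) ^ n * x)
          have h3 := Int.lt_floor_add_one ((b : ℝ) ^ n * x)
          simp only [c]
          constructor <;> linarith [hu.1, hu.2]
        · rw [h.pow_smul_eq] at hmem
          simp only [Set.mem_iUnion, exists_prop] at hmem
          obtain ⟨y, hy, hyx⟩ := hmem
          obtain ⟨z, rfl⟩ : ∃ z, y = z + c n := ⟨y - c n, by ring⟩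
          rw [hvadd, ← vadd_eq_add, Set.vadd_mem_vadd_set_iff] at hyx
          refine Set.mem_biUnion (hn z ?_ hy) hyx
          obtain ⟨v, hv, rfl⟩ := hyx
          have h2 := hC v hv
          rw [mem_closedBall_zero_iff] at hu
          rw [Real.norm_eq_abs, abs_le] at hu h2
          simp only [vadd_eq_add] at hu
          have h3 := Int.le_ceil (R + C : ℝ)
          constructor
          · have : ((-⌈(R + C : ℝ)⌉ : ℤ) : ℝ) ≤ z := by push_cast; linarith [hu.1, h2.2]
            exact_mod_cast this
          · have : (z : ℝ) ≤ ⌈(R + C : ℝ)⌉ := by linarith [hu.2, h2.1]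
            exact_mod_cast this
      have hUle : (U : Filter ℕ) ≤ Filter.atTop := by
        rw [← Nat.cofinite_eq_atTop]
        exact Filter.hyperfilter_le_cofinite
      exact nonpos_iff_eq_zero.1 (ge_of_tendsto (hg.mono_left hUle) hev)
    have hcov : Vᶜ ⊆ ⋃ R : ℕ, Metric.closedBall 0 (R : ℝ) \ V := by
      intro u hu
      obtain ⟨R, hR⟩ := exists_nat_ge ‖u‖
      exact Set.mem_iUnion.2 ⟨R, mem_closedBall_zero_iff.2 hR, hu⟩
    exact measure_mono_null hcov (measure_iUnion_null hR)
  · rintro _ ⟨y, hy, rfl⟩ _ ⟨z, hz, rfl⟩ hyz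
    -- Two translates in the limit already occur together at some finite level.
    obtain ⟨n, hyn, hzn⟩ := (Filter.Eventually.and hy hz).exists
    have h1 := h.measure_inter_level n _ hyn _ hzn (fun e => hyz (by
      simp only [add_left_inj] at e
      rw [e]))
    rwa [hvadd, hvadd, ← Set.vadd_set_inter, measure_vadd] at h1

end IsDigitTile

end

/-! ### Uniqueness for Fourier transforms and a Parseval criterion. -/

noncomputable section

/-- The Fourier transform `ξ ↦ ∫ e^{2πiξx} dμ(x)` of a measure. -/
def expIntegral (μ : Measure ℝ) (ξ : ℝ) : ℂ := ∫ x, unitExp (ξ * x) ∂μ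

theorem integrable_unitExp_mul {μ : Measure ℝ} {f : ℝ → ℂ} (hf : Integrable f μ) (ξ : ℝ) :
    Integrable (fun x => unitExp (ξ * x) * f x) μ := by
  refine hf.bdd_mul (c := 1) ?_ (Filter.Eventually.of_forall fun x => (norm_unitExp _).le)
  exact (continuous_unitExp.comp (continuous_const.mul continuous_id)).aestronglyMeasurable

theorem expIntegral_neg (μ : Measure ℝ) (ξ : ℝ) :
    expIntegral μ (-ξ) = (starRingEnd ℂ) (expIntegral μ ξ) := by
  rw [expIntegral, expIntegral, ← integral_conj]
  simp only [← unitExp_neg, neg_mul]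

theorem expIntegral_zero (μ : Measure ℝ) [IsProbabilityMeasure μ] : expIntegral μ 0 = 1 := by
  simp [expIntegral, unitExp_zero]

theorem continuous_expIntegral (μ : Measure ℝ) [IsFiniteMeasure μ] :
    Continuous (expIntegral μ) := by
  refine continuous_of_dominated (bound := fun _ => 1) (fun ξ => ?_) (fun ξ => ?_)
    (integrable_const _) (Filter.Eventually.of_forall fun x => ?_)
  · exact (continuous_unitExp.comp (continuous_const.mul continuous_id)).aestronglyMeasurable
  · exact Filter.Eventually.of_forall fun x => (norm_unitExp _).le
  · exact continuous_unitExp.comp (continuous_id.mul continuous_const)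

/-- A real integrable function is determined by its integrals against exponentials. -/
theorem ae_eq_zero_of_integral_unitExp_eq_zero_real {μ : Measure ℝ} [IsFiniteMeasure μ]
    {g : ℝ → ℝ} (hg : Integrable g μ)
    (h : ∀ ξ : ℝ, ∫ x, unitExp (ξ * x) * (g x : ℂ) ∂μ = 0) : g =ᵐ[μ] 0 := by
  have hfin : ∀ k : ℝ → ℝ, Integrable k μ →
      IsFiniteMeasure (μ.withDensity fun x => ENNReal.ofReal (k x)) := fun k hk =>
    isFiniteMeasure_withDensity_ofReal hk.2
  have := hfin g hg
  have hneg : Integrable (fun x => -g x) μ := hg.neg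
  have := hfin _ hneg
  have hchar : ∀ k : ℝ → ℝ, Integrable k μ → ∀ t : ℝ,
      charFun (μ.withDensity fun x => ENNReal.ofReal (k x)) t =
        ∫ x, unitExp (t / (2 * Real.pi) * x) * ((max (k x) 0 : ℝ) : ℂ) ∂μ := by
    intro k hk t
    rw [charFun_apply_real, integral_withDensity_eq_integral_toReal_smul₀
      hk.aestronglyMeasurable.aemeasurable.ennreal_ofReal
      (Filter.Eventually.of_forall fun x => ENNReal.ofReal_lt_top)]
    refine integral_congr_ae (Filter.Eventually.of_forall fun x => ?_)
    have hpi : (Real.pi : ℂ) ≠ 0 := by exact_mod_cast Real.pi_ne_zero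
    simp only [ENNReal.toReal_ofReal', Complex.real_smul, unitExp]
    rw [mul_comm]
    congr 2
    push_cast
    field_simp
  -- The positive and negative parts of `g` define finite measures with the same characteristic
  -- function, hence the same measure.
  have heq : (μ.withDensity fun x => ENNReal.ofReal (g x)) =
      μ.withDensity fun x => ENNReal.ofReal (-g x) := by
    refine Measure.ext_of_charFun ?_
    funext t
    rw [hchar g hg, hchar _ hneg, ← sub_eq_zero, ← integral_sub]
    · rw [← h (t / (2 * Real.pi))]
      refine integral_congr_ae (Filter.Eventually.of_forall fun x => ?_)
      simp only
      rw [← mul_sub, ← Complex.ofReal_sub]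
      congr 2
      rcases le_total 0 (g x) with hx | hx
      · rw [max_eq_left hx, max_eq_right (by linarith)]; ring
      · rw [max_eq_right hx, max_eq_left (by linarith)]; ring
    · exact integrable_unitExp_mul hg.pos_part.ofReal _
    · exact integrable_unitExp_mul hneg.pos_part.ofReal _
  rw [withDensity_eq_iff_of_sigmaFinite hg.aestronglyMeasurable.aemeasurable.ennreal_ofReal
    hneg.aestronglyMeasurable.aemeasurable.ennreal_ofReal] at heq
  filter_upwards [heq] with x hx
  rcases le_total 0 (g x) with h0 | h0
  · rw [ENNReal.ofReal_of_nonpos (by linarith : -g x ≤ 0), ENNReal.ofReal_eq_zero] at hx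
    exact le_antisymm hx h0
  · rw [ENNReal.ofReal_of_nonpos h0, eq_comm, ENNReal.ofReal_eq_zero] at hx
    exact le_antisymm h0 (by simpa using hx)

/-- An integrable function is determined by its integrals against exponentials. -/
theorem ae_eq_zero_of_integral_unitExp_eq_zero {μ : Measure ℝ} [IsFiniteMeasure μ]
    {f : ℝ → ℂ} (hf : Integrable f μ) (h : ∀ ξ : ℝ, ∫ x, unitExp (ξ * x) * f x ∂μ = 0) :
    f =ᵐ[μ] 0 := by
  have hconj : ∀ ξ : ℝ, ∫ x, unitExp (ξ * x) * (starRingEnd ℂ) (f x) ∂μ = 0 := by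
    intro ξ
    have h1 := congrArg (starRingEnd ℂ) (h (-ξ))
    rw [← integral_conj, map_zero] at h1
    rw [← h1]
    refine integral_congr_ae (Filter.Eventually.of_forall fun x => ?_)
    simp only [map_mul, neg_mul, unitExp_neg, Complex.conj_conj]
  have hfc : Integrable (fun x => (starRingEnd ℂ) (f x)) μ :=
    hf.congr' (by fun_prop) (by simp)
  have hre : (fun x => (f x).re) =ᵐ[μ] 0 := by
    refine ae_eq_zero_of_integral_unitExp_eq_zero_real hf.re fun ξ => ?_
    have h1 : (fun x => unitExp (ξ * x) * (((f x).re : ℝ) : ℂ)) = fun x =>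
        (2 : ℂ)⁻¹ * (unitExp (ξ * x) * f x + unitExp (ξ * x) * (starRingEnd ℂ) (f x)) := by
      funext x
      rw [Complex.re_eq_add_conj]
      ring
    rw [h1, integral_const_mul, integral_add (integrable_unitExp_mul hf ξ)
      (integrable_unitExp_mul hfc ξ), h, hconj]
    simp
  have him : (fun x => (f x).im) =ᵐ[μ] 0 := by
    refine ae_eq_zero_of_integral_unitExp_eq_zero_real hf.im fun ξ => ?_
    have h1 : (fun x => unitExp (ξ * x) * (((f x).im : ℝ) : ℂ)) = fun x =>
        (2 * Complex.I)⁻¹ * (unitExp (ξ * x) * f x - unitExp (ξ * x) * (starRingEnd ℂ) (f x)) := by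
      funext x
      rw [Complex.im_eq_sub_conj]
      ring
    rw [h1, integral_const_mul, integral_sub (integrable_unitExp_mul hf ξ)
      (integrable_unitExp_mul hfc ξ), h, hconj]
    simp
  filter_upwards [hre, him] with x h1 h2
  exact Complex.ext h1 h2

/-- A vector whose norm is exhausted by its coefficients in an orthonormal family is orthogonal
to every vector that is orthogonal to the family. -/
theorem Orthonormal.inner_eq_zero_of_le_tsum {E ι : Type*} [NormedAddCommGroup E]
    [InnerProductSpace ℂ E] {v : ι → E} (hv : Orthonormal ℂ v) {x g : E}
    (hx : ‖x‖ ^ 2 ≤ ∑' i, ‖inner ℂ (v i) x‖ ^ 2) (hg : ∀ i, inner ℂ (v i) g = 0) :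
    inner ℂ x g = 0 := by
  -- Subtracting from `x` its projection `p` onto a finite subfamily leaves the inner product with
  -- `g` unchanged; Cauchy–Schwarz then involves only the remaining norm.
  have hfin : ∀ s : Finset ι,
      ‖inner ℂ x g‖ ^ 2 ≤ (‖x‖ ^ 2 - ∑ i ∈ s, ‖inner ℂ (v i) x‖ ^ 2) * ‖g‖ ^ 2 := by
    intro s
    set p : E := ∑ i ∈ s, (inner ℂ (v i) x : ℂ) • v i with hp
    have h1 : inner ℂ p g = 0 := by
      rw [hp, sum_inner]
      exact Finset.sum_eq_zero fun i _ => by rw [inner_smul_left, hg, mul_zero]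
    have hvp : ∀ i ∈ s, inner ℂ (v i) p = inner ℂ (v i) x := fun i hi =>
      hv.inner_right_sum (fun i => inner ℂ (v i) x) hi
    have h2 : inner ℂ p (x - p) = 0 := by
      rw [hp, sum_inner, ← hp]
      refine Finset.sum_eq_zero fun i hi => ?_
      rw [inner_smul_left, inner_sub_right, hvp i hi, sub_self, mul_zero]
    have h3 : ‖p‖ ^ 2 = ∑ i ∈ s, ‖inner ℂ (v i) x‖ ^ 2 := by
      have : (inner ℂ p p : ℂ) = ((∑ i ∈ s, ‖inner ℂ (v i) x‖ ^ 2 : ℝ) : ℂ) := by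
        conv_lhs => rw [hp]
        rw [sum_inner, ← hp]
        push_cast
        refine Finset.sum_congr rfl fun i hi => ?_
        rw [inner_smul_left, hvp i hi, Complex.conj_mul']
      rw [← inner_self_eq_norm_sq (𝕜 := ℂ), this]
      exact Complex.ofReal_re _
    have h4 : ‖x‖ ^ 2 = ‖p‖ ^ 2 + ‖x - p‖ ^ 2 := by
      have := norm_add_sq_eq_norm_sq_add_norm_sq_of_inner_eq_zero p (x - p) h2
      rw [add_sub_cancel] at this
      simpa [sq] using this
    have h5 : inner ℂ x g = inner ℂ (x - p) g := by rw [inner_sub_left, h1, sub_zero]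
    rw [h5, ← h3, h4, add_sub_cancel_left, ← mul_pow]
    gcongr
    exact norm_inner_le_norm _ _
  have hs := hv.inner_products_summable x
  have hlim := ((hs.hasSum.const_sub (‖x‖ ^ 2)).mul_const (‖g‖ ^ 2))
  have h1 : ‖inner ℂ x g‖ ^ 2 ≤ (‖x‖ ^ 2 - ∑' i, ‖inner ℂ (v i) x‖ ^ 2) * ‖g‖ ^ 2 :=
    ge_of_tendsto hlim (Filter.Eventually.of_forall hfin)
  have h2 : (‖x‖ ^ 2 - ∑' i, ‖inner ℂ (v i) x‖ ^ 2) * ‖g‖ ^ 2 ≤ 0 :=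
    mul_nonpos_of_nonpos_of_nonneg (by linarith) (by positivity)
  have h3 : ‖inner ℂ x g‖ ^ 2 = 0 := le_antisymm (h1.trans h2) (by positivity)
  simpa using h3

section ExpLp

variable (μ : Measure ℝ) [IsProbabilityMeasure μ]

theorem memLp_unitExp (ξ : ℝ) : MemLp (fun x => unitExp (ξ * x)) 2 μ :=
  MemLp.of_bound
    (continuous_unitExp.comp (continuous_const.mul continuous_id)).aestronglyMeasurable 1
    (Filter.Eventually.of_forall fun _ => (norm_unitExp _).le)

/-- The exponential with frequency `ξ` as an element of `L²(μ)`. -/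
def expLp (ξ : ℝ) : Lp ℂ 2 μ := (memLp_unitExp μ ξ).toLp

theorem coeFn_expLp (ξ : ℝ) : ⇑(expLp μ ξ) =ᵐ[μ] fun x => unitExp (ξ * x) :=
  (memLp_unitExp μ ξ).coeFn_toLp

theorem inner_expLp_left (ξ : ℝ) (f : Lp ℂ 2 μ) :
    inner ℂ (expLp μ ξ) f = ∫ x, unitExp (-ξ * x) * f x ∂μ := by
  rw [L2.inner_def]
  refine integral_congr_ae ?_
  filter_upwards [coeFn_expLp μ ξ] with x hx
  rw [hx, RCLike.inner_apply, ← unitExp_neg, neg_mul, mul_comm]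

theorem inner_expLp (ξ η : ℝ) : inner ℂ (expLp μ ξ) (expLp μ η) = expIntegral μ (η - ξ) := by
  rw [inner_expLp_left, expIntegral]
  refine integral_congr_ae ?_
  filter_upwards [coeFn_expLp μ η] with x hx
  rw [hx, ← unitExp_add]
  congr 1
  ring

theorem norm_expLp (ξ : ℝ) : ‖expLp μ ξ‖ = 1 := by
  have h1 : ‖expLp μ ξ‖ ^ 2 = 1 := by
    rw [← inner_self_eq_norm_sq (𝕜 := ℂ), inner_expLp, sub_self, expIntegral_zero]
    exact Complex.one_re
  exact (pow_eq_one_iff_of_nonneg (norm_nonneg _) two_ne_zero).1 h1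

theorem orthonormal_expLp {ι : Type*} (l : ι → ℝ)
    (h : ∀ i j, i ≠ j → expIntegral μ (l i - l j) = 0) :
    Orthonormal ℂ fun i => expLp μ (l i) :=
  ⟨fun i => norm_expLp μ _, fun i j hij => by
    simp only
    rw [inner_expLp, h j i hij.symm]⟩

/-- Orthogonality together with Parseval's inequality for the exponentials gives a spectrum. -/
theorem isSpectrum_of_one_le_tsum {Λ : Set ℝ} (hΛ : Λ.Countable)
    (horth : ∀ k ∈ Λ, ∀ l ∈ Λ, k ≠ l → expIntegral μ (k - l) = 0)
    (hsum : ∀ ξ, 1 ≤ ∑' l : Λ, ‖expIntegral μ (ξ - l)‖ ^ 2) : IsSpectrum μ Λ := by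
  have hv : Orthonormal ℂ fun l : Λ => expLp μ (l : ℝ) :=
    orthonormal_expLp μ (fun l : Λ => (l : ℝ)) fun i j hij =>
      horth i i.2 j j.2 fun e => hij (Subtype.ext e)
  have hbot : (Submodule.span ℂ (Set.range fun l : Λ => expLp μ (l : ℝ)))ᗮ = ⊥ := by
    rw [Submodule.eq_bot_iff]
    intro f hf
    rw [Submodule.mem_orthogonal] at hf
    -- Parseval's inequality makes `f` orthogonal to every exponential, not only those in `Λ`, so
    -- uniqueness applies.
    have h1 : ∀ ξ, inner ℂ (expLp μ ξ) f = 0 := by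
      intro ξ
      refine hv.inner_eq_zero_of_le_tsum ?_ fun i => hf _ (Submodule.subset_span ⟨i, rfl⟩)
      simp only [norm_expLp, inner_expLp, one_pow]
      exact hsum ξ
    have h2 : ⇑f =ᵐ[μ] 0 := by
      refine ae_eq_zero_of_integral_unitExp_eq_zero
        ((Lp.memLp f).integrable (by norm_num)) fun ξ => ?_
      rw [← h1 (-ξ), inner_expLp_left, neg_neg]
    exact (Lp.eq_zero_iff_ae_eq_zero).2 h2
  refine ⟨hΛ, HilbertBasis.mkOfOrthogonalEqBot hv hbot, fun l => ?_⟩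
  rw [HilbertBasis.coe_mkOfOrthogonalEqBot]
  refine (coeFn_expLp μ l).trans (Filter.Eventually.of_forall fun x => ?_)
  simp only [unitExp]
  push_cast
  ring_nf

end ExpLp

end

/-! ### The normalized measure on T, its spectrum and the conclusion. -/

noncomputable section

/-- The normalized Lebesgue measure on a set. -/
def uniformMeasure (T : Set ℝ) : Measure ℝ := (volume T)⁻¹ • volume.restrict T

theorem expIntegral_uniformMeasure (T : Set ℝ) (ξ : ℝ) :
    expIntegral (uniformMeasure T) ξ = (volume T).toReal⁻¹ • ∫ x in T, unitExp (ξ * x) := by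
  rw [expIntegral, uniformMeasure, integral_smul_measure, ENNReal.toReal_inv]

/-- The Riemann–Lebesgue lemma for the uniform distribution on a set. -/
theorem tendsto_expIntegral_uniformMeasure {T : Set ℝ} (hT : MeasurableSet T) :
    Filter.Tendsto (expIntegral (uniformMeasure T)) (Filter.cocompact ℝ) (nhds 0) := by
  have h1 := Real.tendsto_integral_exp_smul_cocompact (T.indicator fun _ => (1 : ℂ))
  have h2 := (h1.comp (Homeomorph.neg ℝ).isClosedEmbedding.tendsto_cocompact).const_smul
    (volume T).toReal⁻¹
  rw [smul_zero] at h2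
  refine h2.congr fun ξ => ?_
  rw [expIntegral_uniformMeasure, ← integral_indicator hT]
  simp only [Function.comp_apply, Homeomorph.coe_neg]
  congr 1
  refine integral_congr_ae (Filter.Eventually.of_forall fun x => ?_)
  by_cases hx : x ∈ T
  · simp only [Set.indicator_of_mem hx, Circle.smul_def, Real.fourierChar_apply, unitExp,
      smul_eq_mul, mul_one]
    congr 1
    push_cast
    ring
  · simp [Set.indicator_of_notMem hx]

namespace IsDigitTile

variable {ι : Type*} [Fintype ι] {b : ℕ} {d : ι → ℤ} {T : Set ℝ}

theorem isProbabilityMeasure (h : IsDigitTile b d T) : IsProbabilityMeasure (uniformMeasure T) :=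
  ⟨by
    rw [uniformMeasure, Measure.smul_apply, Measure.restrict_apply_univ, smul_eq_mul,
      ENNReal.inv_mul_cancel h.measure_ne_zero h.measure_ne_top]⟩

/-- Rescale the integral to `b • T` and split it into the translates of `T`, whose overlaps are
null. -/
theorem expIntegral_mul (h : IsDigitTile b d T) (ξ : ℝ) :
    expIntegral (uniformMeasure T) (b * ξ) =
      (b : ℂ)⁻¹ * (∑ p, unitExp (d p * ξ)) * expIntegral (uniformMeasure T) ξ := by
  have hb := h.b_pos
  have hcont : Continuous fun x => unitExp (ξ * x) :=
    continuous_unitExp.comp (continuous_const.mul continuous_id)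
  have h1 : ∫ x in T, unitExp (b * ξ * x) =
      (b : ℝ)⁻¹ • ∫ x in (b : ℝ) • T, unitExp (ξ * x) := by
    have := Measure.setIntegral_comp_smul volume (fun x => unitExp (ξ * x)) T (R := (b : ℝ)) hb.ne'
    simp only [smul_eq_mul, Module.finrank_self, pow_one, abs_inv, abs_of_pos hb] at this
    rw [← this]
    refine integral_congr_ae (Filter.Eventually.of_forall fun x => ?_)
    simp only
    congr 1
    ring
  have h2 : ∀ p, ∫ x in (d p : ℝ) +ᵥ T, unitExp (ξ * x) =
      unitExp (d p * ξ) * ∫ x in T, unitExp (ξ * x) := by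
    intro p
    have := (measurePreserving_add_left volume (d p : ℝ)).setIntegral_image_emb
      (MeasurableEquiv.addLeft (d p : ℝ)).measurableEmbedding (fun x => unitExp (ξ * x)) T
    rw [← Set.image_vadd]
    simp only [vadd_eq_add]
    rw [this, ← integral_const_mul]
    refine integral_congr_ae (Filter.Eventually.of_forall fun x => ?_)
    simp only
    rw [← unitExp_add]
    congr 1
    ring
  have h3 : ∫ x in (b : ℝ) • T, unitExp (ξ * x) =
      (∑ p, unitExp (d p * ξ)) * ∫ x in T, unitExp (ξ * x) := by
    rw [h.smul_eq, integral_iUnion_ae, tsum_fintype, Finset.sum_mul]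
    · exact Finset.sum_congr rfl fun p _ => h2 p
    · exact fun p => (h.measurableSet_vadd _).nullMeasurableSet
    · exact fun p q hpq => h.measure_inter_digit hpq
    · exact hcont.continuousOn.integrableOn_compact
        (isCompact_iUnion fun p => h.isCompact.vadd _)
  rw [expIntegral_uniformMeasure, expIntegral_uniformMeasure, h1, h3]
  simp only [Complex.real_smul]
  push_cast
  ring

/-- At integers the digit sum equals `b`, so the transform is constant along `b ^ j * n`; by
Riemann–Lebesgue the constant is 0. -/
theorem expIntegral_int (h : IsDigitTile b d T) {n : ℤ} (hn : n ≠ 0) :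
    expIntegral (uniformMeasure T) n = 0 := by
  have hb := h.b_pos
  have h1 : ∀ k : ℤ, expIntegral (uniformMeasure T) (b * k) = expIntegral (uniformMeasure T) k := by
    intro k
    have hone : ∀ p, unitExp (d p * k) = 1 := fun p => unitExp_eq_one_iff.2 ⟨d p * k, by simp⟩
    have hbc : (b : ℂ) ≠ 0 := by exact_mod_cast hb.ne'
    rw [h.expIntegral_mul]
    simp [hone, h.card_eq, hbc]
  have h2 : ∀ j : ℕ, expIntegral (uniformMeasure T) ((b : ℝ) ^ j * n) =
      expIntegral (uniformMeasure T) n := by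
    intro j
    induction j with
    | zero => simp
    | succ j ih =>
      have := h1 (b ^ j * n)
      push_cast at this
      rw [pow_succ', mul_assoc, this, ih]
  have h3 : Filter.Tendsto (fun j : ℕ => (b : ℝ) ^ j * n) Filter.atTop (Filter.cocompact ℝ) := by
    rw [← Metric.cobounded_eq_cocompact, ← tendsto_norm_atTop_iff_cobounded]
    have h4 : Filter.Tendsto (fun j : ℕ => (b : ℝ) ^ j) Filter.atTop Filter.atTop :=
      tendsto_pow_atTop_atTop_of_one_lt (by
        have := h.two_le
        exact_mod_cast (by omega : 1 < b))
    have h5 : (0 : ℝ) < |(n : ℝ)| := by positivity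
    refine (h4.atTop_mul_const h5).congr fun j => ?_
    rw [norm_mul, Real.norm_eq_abs, Real.norm_eq_abs, abs_of_pos (pow_pos hb j)]
  have h6 := (tendsto_expIntegral_uniformMeasure h.measurableSet).comp h3
  simp only [Function.comp_def, h2] at h6
  exact tendsto_nhds_unique tendsto_const_nhds h6

end IsDigitTile

/-- The digit `a + m c`. -/
def pairDigit (N m L : ℕ) (p : Fin N × Fin L) : ℤ := (p.1 : ℕ) + m * (p.2 : ℕ)

theorem mem_productDigits {N m L : ℕ} {x : ℝ} :
    x ∈ productDigits N m L ↔ ∃ p : Fin N × Fin L, x = pairDigit N m L p := by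
  simp only [productDigits, consecutiveDigits, Set.mem_add, Set.mem_smul_set, Set.mem_image,
    Set.mem_Iio, pairDigit, smul_eq_mul]
  constructor
  · rintro ⟨_, ⟨a, ha, rfl⟩, _, ⟨_, ⟨c, hc, rfl⟩, rfl⟩, rfl⟩
    exact ⟨(⟨a, ha⟩, ⟨c, hc⟩), by push_cast; rfl⟩
  · rintro ⟨⟨a, c⟩, rfl⟩
    exact ⟨a, ⟨a, a.2, rfl⟩, m * c, ⟨c, ⟨c, c.2, rfl⟩, rfl⟩, by push_cast; rfl⟩

theorem sum_unitExp_pairDigit (N m L : ℕ) (ξ : ℝ) :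
    ∑ p, unitExp (pairDigit N m L p * ξ) =
      (∑ a ∈ Finset.range N, unitExp (a * ξ)) * ∑ c ∈ Finset.range L, unitExp (c * (m * ξ)) := by
  rw [← Fin.sum_univ_eq_sum_range (fun a : ℕ => unitExp (a * ξ)),
    ← Fin.sum_univ_eq_sum_range (fun c : ℕ => unitExp (c * (m * ξ))), Finset.sum_mul_sum,
    Fintype.sum_prod_type]
  refine Finset.sum_congr rfl fun a _ => Finset.sum_congr rfl fun c _ => ?_
  rw [← unitExp_add, pairDigit]
  congr 1
  push_cast
  ring

section

variable {N m L : ℕ} {T : Set ℝ}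

theorem IsDigitTile.isRefinable (hN : 2 ≤ N) (hL : 2 ≤ L) (hm : 1 ≤ m)
    (h : IsDigitTile (N * L) (pairDigit N m L) T) :
    IsRefinable N m L fun ξ => ‖expIntegral (uniformMeasure T) ξ‖ ^ 2 := by
  have := h.isProbabilityMeasure
  refine ⟨hN, hL, hm, (continuous_expIntegral _).norm.pow 2, fun ξ => by positivity, ?_, ?_, ?_,
    ?_, ?_⟩
  · simp [expIntegral_zero]
  · intro ξ
    rw [expIntegral_neg, RCLike.norm_conj]
  · intro n hn
    simp [h.expIntegral_int hn]
  · intro ξ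
    have h1 := h.expIntegral_mul ξ
    rw [sum_unitExp_pairDigit] at h1
    push_cast at h1
    rw [h1, digitMask, digitMask]
    simp only [norm_mul, norm_inv, Complex.norm_natCast]
    ring
  · intro ξ
    -- Integer frequencies are orthonormal, so summability of the periodization is Bessel's
    -- inequality.
    have h1 : Orthonormal ℂ fun n : ℤ => expLp (uniformMeasure T) (-n : ℝ) := by
      refine orthonormal_expLp _ (fun n : ℤ => (-n : ℝ)) fun i j hij => ?_
      have := h.expIntegral_int (sub_ne_zero.2 hij.symm)
      push_cast at this
      rw [← this]
      congr 1
      ring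
    have h2 := h1.inner_products_summable (expLp (uniformMeasure T) ξ)
    simpa [inner_expLp] using h2

/-- A self-similar set of positive measure with product digits is a spectral set. -/
theorem IsDigitTile.isSpectralSet (hN : 2 ≤ N) (hL : 2 ≤ L) (hm : 1 ≤ m)
    (h : IsDigitTile (N * L) (pairDigit N m L) T) : IsSpectralSet T := by
  have hprob := h.isProbabilityMeasure
  have hR := h.isRefinable hN hL hm
  have hm0 := hR.m_pos
  obtain ⟨S, hS, hsum⟩ := hR.one_le_spectralSum
  refine ⟨h.measurableSet.nullMeasurableSet, hprob, ⟨T, h.isCompact, ?_⟩, ?_⟩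
  · rw [Measure.smul_apply, Measure.restrict_apply h.measurableSet.compl, Set.compl_inter_self]
    simp
  -- the spectrum is `S / m + ℤ`
  let φ : S × ℤ → ℝ := fun p => -((p.1 : ℤ) / m + p.2)
  have horth : ∀ p q : S × ℤ, p ≠ q → expIntegral (uniformMeasure T) (φ p - φ q) = 0 := by
    rintro ⟨⟨k, hk⟩, i⟩ ⟨⟨l, hl⟩, j⟩ hne
    by_cases hkl : l = k
    · subst hkl
      have hij : j - i ≠ 0 := fun e => hne (by rw [sub_eq_zero.1 e])
      have := h.expIntegral_int hij
      rw [← this]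
      simp only [φ]
      push_cast
      ring_nf
    · have := hS l hl k hk hkl (j - i)
      rw [sq_eq_zero_iff, norm_eq_zero] at this
      rw [← this]
      simp only [φ]
      push_cast
      ring_nf
  have hinj : Function.Injective φ := by
    intro p q hpq
    by_contra hne
    have := horth p q hne
    rw [hpq, sub_self, expIntegral_zero] at this
    exact one_ne_zero this
  refine ⟨Set.range φ, isSpectrum_of_one_le_tsum (uniformMeasure T) (Set.countable_range φ) ?_ ?_⟩
  · rintro _ ⟨p, rfl⟩ _ ⟨q, rfl⟩ hne
    exact horth p q fun e => hne (by rw [e])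
  · intro ξ
    refine (hsum ξ).trans (le_of_eq ?_)
    rw [← (Equiv.ofInjective φ hinj).tsum_eq]
    simp only [Equiv.ofInjective_apply]
    have hv : Orthonormal ℂ fun p : S × ℤ => expLp (uniformMeasure T) (φ p) :=
      orthonormal_expLp _ φ horth
    have hs := hv.inner_products_summable (expLp (uniformMeasure T) ξ)
    simp only [inner_expLp] at hs
    -- The minus sign in `φ` turns `ξ - φ (k, n)` into `ξ + k / m + n`, the argument in the spectral
    -- sum.
    rw [hs.tsum_prod, tsum_fintype, IsRefinable.spectralSum, ← Finset.sum_coe_sort S]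
    refine Finset.sum_congr rfl fun k _ => ?_
    refine tsum_congr fun n => ?_
    simp only [φ]
    congr 3
    ring

theorem not_isSpectralSet_of_measure_zero (h : volume T = 0) : ¬ IsSpectralSet T := by
  rintro ⟨-, hp, -⟩
  have h1 := hp.measure_univ
  rw [Measure.smul_apply, Measure.restrict_apply_univ, h, smul_zero] at h1
  exact zero_ne_one h1

theorem not_isTranslationTile_of_measure_zero (h : volume T = 0) : ¬ IsTranslationTile T := by
  rintro ⟨-, Γ, hΓ, hcov, -⟩
  have h1 : volume (⋃ t ∈ Γ, (t +ᵥ T)) = 0 :=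
    (measure_biUnion_null_iff hΓ).2 fun t _ => by rw [measure_vadd, h]
  have h2 := measure_union_null h1 hcov
  rw [Set.union_compl_self, Real.volume_univ] at h2
  exact ENNReal.top_ne_zero h2

theorem isDigitTile_selfSimilarSet (hN : 2 ≤ N) (hL : 2 ≤ L) {ρ : ℝ}
    (hρ : ρ⁻¹ = (N : ℝ) * (L : ℝ))
    (hpos : volume (selfSimilarSet ρ (productDigits N m L)) ≠ 0) :
    IsDigitTile (N * L) (pairDigit N m L) (selfSimilarSet ρ (productDigits N m L)) := by
  have hNL : 1 < N * L := by nlinarith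
  have hNLr : (1 : ℝ) < N * L := by exact_mod_cast hNL
  have hρ' : ρ = (N * L : ℝ)⁻¹ := by rw [← hρ, inv_inv]
  have h0 : 0 < ρ := by rw [hρ']; positivity
  have h1 : ρ < 1 := by rw [hρ']; exact inv_lt_one_of_one_lt₀ hNLr
  have hD : productDigits N m L = Set.range fun p : Fin N × Fin L => (pairDigit N m L p : ℝ) := by
    ext x
    rw [mem_productDigits]
    simp [eq_comm]
  have hfin : (productDigits N m L).Finite := by rw [hD]; exact Set.finite_range _
  have hne : (productDigits N m L).Nonempty :=
    ⟨_, mem_productDigits.2 ⟨(⟨0, by omega⟩, ⟨0, by omega⟩), rfl⟩⟩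
  obtain ⟨-, hcomp, heq⟩ := (isAttractor_iff_eq_selfSimilarSet h0 h1 hfin hne _).2 rfl
  refine ⟨hNL, by simp, hcomp, hpos, ?_⟩
  set T := selfSimilarSet ρ (productDigits N m L)
  conv_lhs => rw [heq]
  rw [hD, Set.biUnion_range, Set.smul_set_iUnion]
  refine Set.iUnion_congr fun p => ?_
  rw [← Set.image_smul, ← Set.image_vadd, Set.image_image]
  refine Set.image_congr fun x _ => ?_
  rw [smul_eq_mul, vadd_eq_add, hρ']
  push_cast
  rw [mul_inv_cancel_left₀ (by positivity), add_comm]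

end

end

theorem theorem1p3 (N m L : ℕ) (hN : 2 ≤ N) (hL : 2 ≤ L) (hm : 1 ≤ m)
    (ρ : ℝ) (hρ : ρ⁻¹ = (N : ℝ) * (L : ℝ)) :
    IsSpectralSet (selfSimilarSet ρ (productDigits N m L)) ↔
      IsTranslationTile (selfSimilarSet ρ (productDigits N m L)) := by
  by_cases h : volume (selfSimilarSet ρ (productDigits N m L)) = 0
  · exact iff_of_false (not_isSpectralSet_of_measure_zero h)
      (not_isTranslationTile_of_measure_zero h)
  · have hT := isDigitTile_selfSimilarSet hN hL hρ h
    exact iff_of_true (hT.isSpectralSet hN hL hm) hT.isTranslationTile
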